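/- Let $\Omega\subset\mathbb{R}^2$ be bounded, connected and open, with Lipschitz boundary, let $\mathcal{A}:L^2(\Omega)\to L^2(\Omega)$ be bounded and linear (real-valued functions), and let $\lambda,\mu>0$. Let $f_1,\dots,f_d\in L^2(\Omega)$ and let $\Omega_0^1,\dots,\Omega_0^d\subseteq\Omega$ be nonempty open sets, with indicator functions $\omega_i=\mathbf 1_{\Omega_0^i}$. Fix $i\in\{1,\dots,d\}$ and assume that $\mathrm{Ker}(\omega_i\mathcal{A})\cap\mathrm{Ker}(\nabla)=\{0\}$, where $(\omega_i\mathcal{A})u=\omega_i\cdot(\mathcal{A}u)$ and $\mathrm{Ker}(\nabla)$ is the set of $u\in L^2(\Omega)$ with weak gradient $0$. For $g\in W^{1,2}(\Omega)$ put $$E(g)=\frac{\lambda}{2}\int_\Omega\omega_i\,\Phi(f_i,g)\,dx+\frac{\mu}{2}\int_\Omega|\nabla g|^2\,dx+\int_\Omega|\nabla g|\,dx .$$ 1. (Gaussian fidelity) If $\Phi(f,g)=(f-\mathcal{A}g)^2$, then $E$ has a unique minimizer in $W^{1,2}(\Omega)$. 2. (Poisson fidelity) Let $\Phi(f,g)=\mathcal{A}g-f\log(\mathcal{A}g)$,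 with values in $(-\infty,+\infty]$, where $0\log 0=0$, $-f\log 0=+\infty$ for $f>0$, and $\Phi=+\infty$ wherever $\mathcal{A}g<0$. Assume that $f_i\ge 0$ a.e. on $\Omega_0^i$ and that $E(h)<+\infty$ for some $h\in W^{1,2}(\Omega)$. Then $E$ has a minimizer in $W^{1,2}(\Omega)$. If moreover $\mathcal{A}\mathbf 1\ge 0$ a.e. on $\{x\in\Omega_0^i: f_i(x)=0\}$, where $\mathbf 1$ is the constant function $1$ (in particular, if $f_i>0$ a.e. on $\Omega_0^i$, or if $\mathcal{A}$ maps nonnegative functions to nonnegative functions), then the minimizer is unique. -/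

import Mathlib

open MeasureTheory
open scoped ENNReal NNReal ContDiff

noncomputable section

namespace Slat

/-- The Euclidean plane. -/
abbrev Plane : Type := EuclideanSpace ℝ (Fin 2)

/-- Real-valued `L²(Ω)`, with respect to Lebesgue measure. -/
abbrev L2 (Ω : Set Plane) : Type := Lp ℝ 2 (volume.restrict Ω)

/-- `ℝ²`-valued `L²(Ω)`, with respect to Lebesgue measure. -/
abbrev L2Vec (Ω : Set Plane) : Type := Lp Plane 2 (volume.restrict Ω)

/-- `Ω` has a Lipschitz boundary: near each boundary point, in suitable orthonormal coordinates
`(y₀, y₁) = R y`, the set `Ω` is the region strictly above the graph of a Lipschitz function. -/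
def HasLipschitzBoundary (Ω : Set Plane) : Prop :=
  ∀ x ∈ frontier Ω, ∃ r : ℝ, 0 < r ∧
    ∃ (R : Plane ≃ₗᵢ[ℝ] Plane) (K : ℝ≥0) (γ : ℝ → ℝ), LipschitzWith K γ ∧
      Ω ∩ Metric.ball x r = {y : Plane | γ (R y 0) < R y 1} ∩ Metric.ball x r

/-- `G` is the weak (distributional) gradient of `u` in `Ω`, tested against `C_c^∞(Ω)` in every
direction `v`. -/
def IsWeakGradient (Ω : Set Plane) (u : L2 Ω) (G : L2Vec Ω) : Prop :=
  ∀ φ : Plane → ℝ, ContDiff ℝ ∞ φ → HasCompactSupport φ → tsupport φ ⊆ Ω → ∀ v : Plane,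
    ∫ x in Ω, u x * fderiv ℝ φ x v = - ∫ x in Ω, inner ℝ (G x) v * φ x

/-- The Sobolev space `W^{1,2}(Ω)`, as a subset of `L²(Ω)`. -/
def W12 (Ω : Set Plane) : Set (L2 Ω) := {u | ∃ G : L2Vec Ω, IsWeakGradient Ω u G}

open Classical in
/-- The weak gradient `∇u` of `u ∈ W^{1,2}(Ω)` (and `0` for other `u`). -/
def weakGrad (Ω : Set Plane) (u : L2 Ω) : L2Vec Ω :=
  if h : ∃ G : L2Vec Ω, IsWeakGradient Ω u G then h.choose else 0

/-- `Ker(∇)`: the functions in `L²(Ω)` whose weak gradient exists and vanishes. -/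
def kerGrad (Ω : Set Plane) : Set (L2 Ω) := {u | IsWeakGradient Ω u 0}

/-- `Ker(ω𝒜)`, where `ω` is the indicator function of `Ω₀` and `(ω𝒜)u = ω · (𝒜u)`. -/
def kerMasked (Ω Ω₀ : Set Plane) (A : L2 Ω →L[ℝ] L2 Ω) : Set (L2 Ω) :=
  {u | ∀ᵐ x ∂(volume.restrict Ω), Ω₀.indicator (fun y => A u y) x = 0}

/-- The integral of an extended real valued function: integral of the positive part minus integral
of the negative part. (It is only used where the negative part has a finite integral.) -/
def eintegral (μ : Measure Plane) (h : Plane → EReal) : EReal :=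
  ((∫⁻ x, (h x).toENNReal ∂μ : ℝ≥0∞) : EReal) - ((∫⁻ x, (-h x).toENNReal ∂μ : ℝ≥0∞) : EReal)

/-- The Gaussian fidelity `(s - t)²` of the datum `s` and the value `t = 𝒜g(x)`. -/
def gaussFid (s t : ℝ) : EReal := (((s - t) ^ 2 : ℝ) : EReal)

/-- The Poisson fidelity `t - s log t` of the datum `s ≥ 0` and the value `t = 𝒜g(x)`, as an extended
real number: `0 log 0 = 0`, `- s log 0 = +∞` for `s ≠ 0`, and `+∞` for `t < 0`. -/
def poissonFid (s t : ℝ) : EReal :=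
  if 0 < t then ((t - s * Real.log t : ℝ) : EReal)
  else if t = 0 ∧ s = 0 then 0
  else ⊤

/-- The functional
`E(g) = (λ/2) ∫_Ω ω Φ(f, g) dx + (μ/2) ∫_Ω |∇g|² dx + ∫_Ω |∇g| dx`,
where `Φ(f, g)(x) = φ (f x) (𝒜g x)` and `ω` is the indicator function of `Ω₀`. -/
def energy (Ω Ω₀ : Set Plane) (A : L2 Ω →L[ℝ] L2 Ω) (lam mu : ℝ) (φ : ℝ → ℝ → EReal)
    (f g : L2 Ω) : EReal :=
  ((lam / 2 : ℝ) : EReal) *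
      eintegral (volume.restrict Ω) (Ω₀.indicator fun x => φ (f x) (A g x))
    + ((mu / 2 * ∫ x in Ω, ‖weakGrad Ω g x‖ ^ 2 : ℝ) : EReal)
    + ((∫ x in Ω, ‖weakGrad Ω g x‖ : ℝ) : EReal)

/-- `g` is a minimizer of `E` over `W^{1,2}(Ω)`. -/
def IsMinimizer (Ω : Set Plane) (E : L2 Ω → EReal) (g : L2 Ω) : Prop :=
  g ∈ W12 Ω ∧ ∀ h ∈ W12 Ω, E g ≤ E h

end Slat

end

namespace Slat

/-! Existence is the direct method run with strong convergence. The term `(μ/2)‖∇g‖²` satisfies the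
parallelogram law and the other terms are midpoint convex, so along a minimizing sequence the
gradients are Cauchy in `L²` (`total_midpoint`). A Poincaré inequality modulo finitely many bounded
functionals (`poincareOn_self`) then replaces Rellich: for a bounded sequence with Cauchy gradients,
only finitely many real sequences remain to be made convergent (`exists_subseq_tendsto`). The same
compactness, with the kernel hypothesis, bounds `‖u‖` by the `L¹` norm of `ω𝒜u` and the gradient
(`exists_norm_le`), hence minimizing sequences are bounded. Fatou gives lower semicontinuity of the
fidelity.

The Poincaré inequality is local. On balls it follows from averaging translation estimates; near the
boundary, a piece of `Ω` is pushed upwards off the Lipschitz graph into a compact subset of `Ω`.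
Compactness of the closure leaves finitely many pieces.

For uniqueness, the same midpoint gap shows that two minimizers `g`, `g'` have equal gradients, and
that the fidelity integrand is affine between `𝒜g` and `𝒜g'` (`minimizer_total_pair`). Strict
convexity yields `𝒜g = 𝒜g'` on `Ω₀`, and the kernel hypothesis yields `g = g'`. The Poisson
integrand is strictly convex only where `f > 0`. Where `f = 0` it equals `𝒜g`; as `g - g'` is a
constant, the sign of `𝒜1` orders `𝒜g` and `𝒜g'` there, and equality of the integrals forces them to
agree.

Both fidelities are shifted by `f²`, which makes them `[0,∞]`-valued and changes the energy by a
finite constant. -/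

theorem memLp_of_hasCompactSupport {F : Type*} [NormedAddCommGroup F] {μ : Measure Plane}
    [IsFiniteMeasureOnCompacts μ] {φ : Plane → F} (hφ : Continuous φ)
    (hc : HasCompactSupport φ) : MemLp φ 2 μ := by
  exact hφ.memLp_of_hasCompactSupport hc

theorem memLp_fderiv_apply {μ : Measure Plane} [IsFiniteMeasureOnCompacts μ] {φ : Plane → ℝ}
    (hφ : ContDiff ℝ ∞ φ) (hc : HasCompactSupport φ) (v : Plane) :
    MemLp (fun x => fderiv ℝ φ x v) 2 μ :=
  memLp_of_hasCompactSupport ((hφ.continuous_fderiv (by simp)).clm_apply continuous_const)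
    (hc.fderiv_apply (𝕜 := ℝ) v)

theorem memLp_smul_const {μ : Measure Plane} [IsFiniteMeasureOnCompacts μ] {φ : Plane → ℝ}
    (hφ : ContDiff ℝ ∞ φ) (hc : HasCompactSupport φ) (v : Plane) :
    MemLp (fun x => φ x • v) 2 μ :=
  memLp_of_hasCompactSupport (hφ.continuous.smul continuous_const) hc.smul_right

/-! ### Weak gradients as a closed linear relation -/

theorem inner_toLp_real {μ : Measure Plane} {ψ : Plane → ℝ} (hψ : MemLp ψ 2 μ) (u : Lp ℝ 2 μ) :
    inner ℝ (hψ.toLp ψ) u = ∫ x, u x * ψ x ∂μ := by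
  rw [L2.inner_def]
  refine integral_congr_ae ?_
  filter_upwards [hψ.coeFn_toLp] with x hx
  simp [hx]

theorem inner_toLp_smul {μ : Measure Plane} {φ : Plane → ℝ} {v : Plane}
    (hψ : MemLp (fun x => φ x • v) 2 μ) (G : Lp Plane 2 μ) :
    inner ℝ (hψ.toLp _) G = ∫ x, inner ℝ (G x) v * φ x ∂μ := by
  rw [L2.inner_def]
  refine integral_congr_ae ?_
  filter_upwards [hψ.coeFn_toLp] with x hx
  rw [hx, inner_smul_left, real_inner_comm, mul_comm]
  simp

/-- Each test condition is the vanishing of a continuous linear functional of `(u, G)`, so linearity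
and closedness of the relation become immediate. -/
theorem isWeakGradient_iff (Ω : Set Plane) (u : L2 Ω) (G : L2Vec Ω) :
    IsWeakGradient Ω u G ↔ ∀ (φ : Plane → ℝ) (hφ : ContDiff ℝ ∞ φ) (hc : HasCompactSupport φ),
      tsupport φ ⊆ Ω → ∀ v : Plane,
      inner ℝ ((memLp_fderiv_apply hφ hc v).toLp _) u
        + inner ℝ ((memLp_smul_const hφ hc v).toLp _) G = 0 := by
  simp only [inner_toLp_real, inner_toLp_smul, IsWeakGradient, add_eq_zero_iff_eq_neg]

/-- The graph of the weak gradient, as a linear subspace. -/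
def gradGraph (Ω : Set Plane) : Submodule ℝ (L2 Ω × L2Vec Ω) where
  carrier := {p | IsWeakGradient Ω p.1 p.2}
  zero_mem' := by
    simp [isWeakGradient_iff]
  add_mem' := by
    intro a b ha hb
    simp only [Set.mem_ofPred_eq, isWeakGradient_iff, Prod.fst_add, Prod.snd_add,
      inner_add_right] at *
    intro φ hφ hc hs v
    linarith [ha φ hφ hc hs v, hb φ hφ hc hs v]
  smul_mem' := by
    intro c a ha
    simp only [Set.mem_ofPred_eq, isWeakGradient_iff, Prod.smul_fst, Prod.smul_snd,
      inner_smul_right] at *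
    intro φ hφ hc hs v
    rw [← mul_add, ha φ hφ hc hs v, mul_zero]

theorem mem_gradGraph {Ω : Set Plane} {u : L2 Ω} {G : L2Vec Ω} :
    (u, G) ∈ gradGraph Ω ↔ IsWeakGradient Ω u G := Iff.rfl

theorem isClosed_gradGraph (Ω : Set Plane) : IsClosed (gradGraph Ω : Set (L2 Ω × L2Vec Ω)) := by
  have : (gradGraph Ω : Set (L2 Ω × L2Vec Ω)) = {p | IsWeakGradient Ω p.1 p.2} := rfl
  rw [this]
  simp only [isWeakGradient_iff, Set.ofPred_forall]
  refine isClosed_iInter fun φ => isClosed_iInter fun hφ => isClosed_iInter fun hc =>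
    isClosed_iInter fun hs => isClosed_iInter fun v => ?_
  exact isClosed_eq (by fun_prop) continuous_const

theorem IsWeakGradient.add {Ω : Set Plane} {u u' : L2 Ω} {G G' : L2Vec Ω}
    (h : IsWeakGradient Ω u G) (h' : IsWeakGradient Ω u' G') :
    IsWeakGradient Ω (u + u') (G + G') :=
  (gradGraph Ω).add_mem (mem_gradGraph.2 h) (mem_gradGraph.2 h')

theorem IsWeakGradient.sub {Ω : Set Plane} {u u' : L2 Ω} {G G' : L2Vec Ω}
    (h : IsWeakGradient Ω u G) (h' : IsWeakGradient Ω u' G') :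
    IsWeakGradient Ω (u - u') (G - G') :=
  (gradGraph Ω).sub_mem (mem_gradGraph.2 h) (mem_gradGraph.2 h')

theorem IsWeakGradient.smul {Ω : Set Plane} {u : L2 Ω} {G : L2Vec Ω} (c : ℝ)
    (h : IsWeakGradient Ω u G) : IsWeakGradient Ω (c • u) (c • G) :=
  (gradGraph Ω).smul_mem c (mem_gradGraph.2 h)

theorem isWeakGradient_of_tendsto {Ω : Set Plane} {u : ℕ → L2 Ω} {G : ℕ → L2Vec Ω}
    {u₀ : L2 Ω} {G₀ : L2Vec Ω} (h : ∀ n, IsWeakGradient Ω (u n) (G n))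
    (hu : Filter.Tendsto u Filter.atTop (nhds u₀)) (hG : Filter.Tendsto G Filter.atTop (nhds G₀)) :
    IsWeakGradient Ω u₀ G₀ :=
  (isClosed_gradGraph Ω).mem_of_tendsto (hu.prodMk_nhds hG) (Filter.Eventually.of_forall h)

/-- This is the fundamental lemma of the calculus of variations, applied to the difference of the
two gradients. -/
theorem IsWeakGradient.unique {Ω : Set Plane} (hΩ : IsOpen Ω) {u : L2 Ω} {G G' : L2Vec Ω}
    (h : IsWeakGradient Ω u G) (h' : IsWeakGradient Ω u G') : G = G' := by
  have h0 : IsWeakGradient Ω 0 (G - G') := by simpa using h.sub h'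
  rw [← sub_eq_zero]
  set D := G - G'
  rw [isWeakGradient_iff] at h0
  have hloc : LocallyIntegrable D (volume.restrict Ω) :=
    (Lp.memLp D).locallyIntegrable (by norm_num)
  have : ∀ᵐ x ∂volume.restrict Ω, x ∈ Ω → D x = 0 := by
    refine hΩ.ae_eq_zero_of_integral_contDiff_smul_eq_zero (hloc.locallyIntegrableOn Ω) ?_
    intro φ hφ hc hs
    have hI : Integrable (fun x => φ x • D x) (volume.restrict Ω) := by
      exact hloc.integrable_smul_left_of_hasCompactSupport hφ.continuous hc
    -- The integral is vector valued while the hypothesis is scalar for each direction, so it is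
    -- paired with every `v`.
    refine ext_inner_left ℝ fun v => ?_
    rw [← integral_inner hI]
    have := h0 φ hφ hc hs v
    rw [inner_zero_right, zero_add, inner_toLp_smul] at this
    rw [inner_zero_right, ← this]
    refine integral_congr_ae (Filter.Eventually.of_forall fun x => ?_)
    simp [inner_smul_right, real_inner_comm, mul_comm]
  refine Lp.ext ?_
  filter_upwards [this, ae_restrict_mem hΩ.measurableSet, Lp.coeFn_zero Plane 2 (volume.restrict Ω)]
    with x hx hxΩ h0
  rw [hx hxΩ, h0]; rfl

theorem isWeakGradient_weakGrad {Ω : Set Plane} {u : L2 Ω} (h : u ∈ W12 Ω) :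
    IsWeakGradient Ω u (weakGrad Ω u) := by
  have h' : ∃ G : L2Vec Ω, IsWeakGradient Ω u G := h
  rw [weakGrad, dif_pos h']
  exact h'.choose_spec

theorem IsWeakGradient.weakGrad_eq {Ω : Set Plane} (hΩ : IsOpen Ω) {u : L2 Ω} {G : L2Vec Ω}
    (h : IsWeakGradient Ω u G) : weakGrad Ω u = G :=
  (isWeakGradient_weakGrad ⟨G, h⟩).unique hΩ h

/-! ### Translation estimates -/

/-- By duality, an `L²` bound can be tested against smooth functions with compact support. -/
theorem eLpNorm_le_of_forall_integral_le {S : Set Plane} (hS : IsOpen S) {w : Plane → ℝ}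
    (hw : MemLp w 2 (volume.restrict S)) {M : ℝ} (hM : 0 ≤ M)
    (h : ∀ φ : Plane → ℝ, ContDiff ℝ ∞ φ → HasCompactSupport φ → tsupport φ ⊆ S →
      |∫ x in S, w x * φ x| ≤ M * (eLpNorm φ 2 (volume.restrict S)).toReal) :
    eLpNorm w 2 (volume.restrict S) ≤ ENNReal.ofReal M := by
  set W : Lp ℝ 2 (volume.restrict S) := hw.toLp w with hW
  let K : Submodule ℝ (Lp ℝ 2 (volume.restrict S)) :=
    { carrier := {f | ∃ (φ : Plane → ℝ) (_ : ContDiff ℝ ∞ φ) (_ : HasCompactSupport φ)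
        (_ : tsupport φ ⊆ S) (hm : MemLp φ 2 (volume.restrict S)), hm.toLp φ = f}
      zero_mem' := ⟨0, contDiff_const, HasCompactSupport.zero, by
        simp [tsupport, Function.support_zero], MemLp.zero, rfl⟩
      add_mem' := by
        rintro a b ⟨φ, h1, h2, h3, hm, rfl⟩ ⟨φ', h1', h2', h3', hm', rfl⟩
        exact ⟨φ + φ', h1.add h1', h2.add h2', (tsupport_add φ φ').trans
          (Set.union_subset h3 h3'), hm.add hm', rfl⟩
      smul_mem' := by
        rintro c a ⟨φ, h1, h2, h3, hm, rfl⟩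
        refine ⟨c • φ, h1.const_smul c, h2.smul_left (f := fun _ => c), ?_, hm.const_smul c, rfl⟩
        exact (closure_mono (Function.support_const_smul_subset c φ)).trans h3 }
  -- Test functions are dense because anything orthogonal to them vanishes; the bound then extends
  -- by continuity to all of `L²` and is tested on `W` itself.
  have hKd : K.topologicalClosure = ⊤ := by
    rw [Submodule.topologicalClosure_eq_top_iff, Submodule.eq_bot_iff]
    intro f hf
    have : ∀ᵐ x ∂volume.restrict S, x ∈ S → f x = 0 := by
      refine hS.ae_eq_zero_of_integral_contDiff_smul_eq_zero
        (((Lp.memLp f).locallyIntegrable (by norm_num)).locallyIntegrableOn S) ?_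
      intro φ hφ hc hs
      have hm : MemLp φ 2 (volume.restrict S) := memLp_of_hasCompactSupport hφ.continuous hc
      have := (Submodule.mem_orthogonal K f).1 hf _ ⟨φ, hφ, hc, hs, hm, rfl⟩
      rw [inner_toLp_real] at this
      rw [← this]
      simp [mul_comm]
    refine Lp.ext ?_
    filter_upwards [this, ae_restrict_mem hS.measurableSet,
      Lp.coeFn_zero ℝ 2 (volume.restrict S)] with x hx hxΩ h0
    rw [hx hxΩ, h0]; rfl
  have hb : ∀ f : Lp ℝ 2 (volume.restrict S), |inner ℝ f W| ≤ M * ‖f‖ := by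
    intro f
    have hcl : IsClosed {f : Lp ℝ 2 (volume.restrict S) | |inner ℝ f W| ≤ M * ‖f‖} :=
      isClosed_le (by fun_prop) (by fun_prop)
    have hsub : (K : Set (Lp ℝ 2 (volume.restrict S))) ⊆ {f | |inner ℝ f W| ≤ M * ‖f‖} := by
      rintro _ ⟨φ, h1, h2, h3, hm, rfl⟩
      have := h φ h1 h2 h3
      rw [Set.mem_ofPred_eq, Lp.norm_toLp, inner_toLp_real]
      refine le_trans (le_of_eq ?_) this
      congr 1
      refine integral_congr_ae ?_
      filter_upwards [hw.coeFn_toLp] with x hx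
      rw [hx]
    have : f ∈ (K.topologicalClosure : Set _) := by rw [hKd]; trivial
    exact closure_minimal hsub hcl this
  have hWn : ‖W‖ ≤ M := by
    have := hb W
    rw [real_inner_self_eq_norm_sq, abs_of_nonneg (sq_nonneg _)] at this
    by_contra! hlt
    nlinarith [hM.trans_lt hlt]
  rw [← ENNReal.ofReal_toReal hw.eLpNorm_ne_top, ← Lp.norm_toLp w hw]
  exact ENNReal.ofReal_le_ofReal hWn

theorem eLpNorm_two_sq {α F : Type*} [MeasurableSpace α] [NormedAddCommGroup F] (μ : Measure α)
    (f : α → F) : eLpNorm f 2 μ ^ 2 = ∫⁻ x, ‖f x‖ₑ ^ 2 ∂μ := by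
  have := eLpNorm_nnreal_pow_eq_lintegral (μ := μ) (f := f) (p := 2) (by norm_num)
  simpa using this

/-- Pairing a weak gradient with `φ • w`. -/
theorem abs_integral_inner_mul_le {Ω : Set Plane} (G : L2Vec Ω) (w : Plane) {φ : Plane → ℝ}
    (hφ : ContDiff ℝ ∞ φ) (hc : HasCompactSupport φ) :
    |∫ x in Ω, inner ℝ (G x) w * φ x| ≤ ‖w‖ * ‖G‖ * (eLpNorm φ 2 volume).toReal := by
  rw [← inner_toLp_smul (memLp_smul_const hφ hc w)]
  refine (abs_real_inner_le_norm _ _).trans ?_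
  rw [Lp.norm_toLp]
  have hfin : eLpNorm φ 2 volume ≠ ⊤ :=
    (memLp_of_hasCompactSupport (μ := volume) hφ.continuous hc).eLpNorm_ne_top
  have h1 : eLpNorm (fun x => φ x • w) 2 (volume.restrict Ω) ≤ ‖w‖ₑ * eLpNorm φ 2 volume := by
    refine (eLpNorm_mono_measure _ Measure.restrict_le_self).trans ?_
    refine eLpNorm_le_nnreal_smul_eLpNorm_of_ae_le_mul (c := ‖w‖₊) ?_ 2 |>.trans (le_of_eq rfl)
    refine Filter.Eventually.of_forall fun x => ?_
    rw [nnnorm_smul, mul_comm]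
  have h2 := ENNReal.toReal_mono (ENNReal.mul_ne_top enorm_ne_top hfin) h1
  rw [ENNReal.toReal_mul, toReal_enorm] at h2
  calc _ ≤ (‖w‖ * (eLpNorm φ 2 volume).toReal) * ‖G‖ := by gcongr
    _ = _ := by ring

/-- The translation sits on the test function, so one may differentiate under the integral with no
regularity of `u`; the dominating function is `|u|` times a bound for the derivative of `φ`. -/
theorem hasDerivAt_integral_translate {Ω : Set Plane} {u : Plane → ℝ}
    (hu : Integrable u (volume.restrict Ω)) {φ : Plane → ℝ} (hφ : ContDiff ℝ ∞ φ)
    (hc : HasCompactSupport φ) (w : Plane) (t : ℝ) :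
    HasDerivAt (fun t : ℝ => ∫ y in Ω, u y * φ (y - t • w))
      (-∫ y in Ω, u y * fderiv ℝ φ (y - t • w) w) t := by
  have hdc : Continuous fun y => fderiv ℝ φ y w :=
    (hφ.continuous_fderiv (by simp)).clm_apply continuous_const
  obtain ⟨C, hC⟩ := (hc.fderiv_apply (𝕜 := ℝ) w).exists_bound_of_continuous hdc
  obtain ⟨C', hC'⟩ := hc.exists_bound_of_continuous hφ.continuous
  have key := (hasDerivAt_integral_of_dominated_loc_of_deriv_le (μ := volume.restrict Ω)
    (F := fun (t : ℝ) y => u y * φ (y - t • w))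
    (F' := fun (t : ℝ) y => u y * -(fderiv ℝ φ (y - t • w) w))
    (bound := fun y => ‖u y‖ * C) (x₀ := t) (s := Set.univ) Filter.univ_mem ?_ ?_ ?_ ?_ ?_ ?_).2
  · simpa [integral_neg] using key
  · exact Filter.Eventually.of_forall fun t => hu.aestronglyMeasurable.mul
      (hφ.continuous.comp (by fun_prop)).aestronglyMeasurable
  · refine hu.mul_bdd (c := C') (hφ.continuous.comp (by fun_prop)).aestronglyMeasurable ?_
    exact Filter.Eventually.of_forall fun y => hC' _
  · exact hu.aestronglyMeasurable.mul
      (hdc.comp (by fun_prop : Continuous fun y : Plane => y - t • w)).neg.aestronglyMeasurable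
  · refine Filter.Eventually.of_forall fun y s _ => ?_
    rw [norm_mul, norm_neg]
    gcongr
    exact hC _
  · exact hu.norm.mul_const C
  · refine Filter.Eventually.of_forall fun y s _ => ?_
    have h1 : HasDerivAt (fun s : ℝ => y - s • w) (-w) s := by
      simpa using ((hasDerivAt_id s).smul_const w).const_sub y
    have h2 := ((hφ.differentiable (by simp)) (y - s • w)).hasFDerivAt.comp_hasDerivAt s h1
    simpa using h2.const_mul (u y)

/-- The `L²` modulus of continuity of a Sobolev function under translation. -/
theorem eLpNorm_translate_sub_le {Ω S : Set Plane} [IsFiniteMeasure (volume.restrict Ω)]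
    (hΩ : IsOpen Ω) (hS : IsOpen S) {w : Plane}
    (hw : ∀ x ∈ S, ∀ t ∈ Set.Icc (0 : ℝ) 1, x + t • w ∈ Ω) {u : L2 Ω} {G : L2Vec Ω}
    (h : IsWeakGradient Ω u G) :
    eLpNorm (fun x => u (x + w) - u x) 2 (volume.restrict S) ≤ ENNReal.ofReal (‖w‖ * ‖G‖) := by
  have hu2 := Lp.memLp u
  have hu : Integrable u (volume.restrict Ω) := hu2.integrable (by norm_num)
  have hSΩ : S ⊆ Ω := fun x hx => by simpa using hw x hx 0 (by simp)
  set s : Set Plane := {y | y - w ∈ S} with hs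
  have hsm : IsOpen s := hS.preimage (by fun_prop)
  have hsΩ : s ⊆ Ω := fun y hy => by simpa using hw _ hy 1 (by simp)
  have hpre : (fun x => x + w) ⁻¹' s = S := by ext; simp [hs]
  have hmp := (measurePreserving_add_right (volume : Measure Plane) w).restrict_preimage
    hsm.measurableSet
  rw [hpre] at hmp
  have hτ : MemLp (fun x => u (x + w)) 2 (volume.restrict S) :=
    (hu2.mono_measure (Measure.restrict_mono hsΩ le_rfl)).comp_measurePreserving hmp
  have hu2S := hu2.mono_measure (Measure.restrict_mono hSΩ le_rfl)
  refine eLpNorm_le_of_forall_integral_le hS (hτ.sub hu2S) (by positivity) ?_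
  intro φ hφ hc hφS
  have hφ2 : MemLp φ 2 (volume.restrict S) := memLp_of_hasCompactSupport hφ.continuous hc
  -- `F t` pairs `u` with `φ` moved by `t • w`. The quantity to bound is `F 1 - F 0`, and `F'` pairs
  -- the weak gradient with the moved `φ`, so the mean value inequality applies.
  set F : ℝ → ℝ := fun t => ∫ y in Ω, u y * φ (y - t • w) with hF
  have hF1 : F 1 = ∫ x in S, u (x + w) * φ x := by
    have h1 : F 1 = ∫ y in s, u y * φ (y - w) := by
      simp only [hF, one_smul]
      refine setIntegral_eq_of_subset_of_forall_sdiff_eq_zero hΩ.measurableSet hsΩ ?_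
      intro y hy
      have : y - w ∉ tsupport φ := fun hy' => hy.2 (hφS hy')
      rw [image_eq_zero_of_notMem_tsupport this, mul_zero]
    rw [h1]
    have := (measurePreserving_add_right (volume : Measure Plane) w).setIntegral_preimage_emb
      (measurableEmbedding_addRight w) (fun y => u y * φ (y - w)) s
    rw [← this, hpre]
    simp
  have hF0 : F 0 = ∫ x in S, u x * φ x := by
    simp only [hF, zero_smul, sub_zero]
    refine setIntegral_eq_of_subset_of_forall_sdiff_eq_zero hΩ.measurableSet hSΩ ?_
    intro y hy
    rw [image_eq_zero_of_notMem_tsupport fun hy' => hy.2 (hφS hy'), mul_zero]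
  have hdiff : ∫ x in S, (u (x + w) - u x) * φ x = F 1 - F 0 := by
    have h1 : Integrable (fun x => u (x + w) * φ x) (volume.restrict S) := hτ.integrable_mul hφ2
    have h0 : Integrable (fun x => u x * φ x) (volume.restrict S) := hu2S.integrable_mul hφ2
    rw [hF1, hF0, ← integral_sub h1 h0]
    simp only [sub_mul]
  change |∫ x in S, (u (x + w) - u x) * φ x| ≤ _
  rw [hdiff, eLpNorm_restrict_eq_of_support_subset ((subset_tsupport φ).trans hφS)]
  refine norm_image_sub_le_of_norm_deriv_le_segment_01'
    (fun t _ => (hasDerivAt_integral_translate hu hφ hc w t).hasDerivWithinAt) ?_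
  intro t ht
  set ψ : Plane → ℝ := fun y => φ (y - t • w) with hψdef
  have hψ : ContDiff ℝ ∞ ψ := hφ.comp (contDiff_id.sub contDiff_const)
  have hψc : HasCompactSupport ψ := hc.comp_homeomorph (Homeomorph.subRight (t • w))
  -- The whole segment from `x` to `x + w` lies in `Ω`, which makes every intermediate translate of
  -- `φ` an admissible test function.
  have hψs : tsupport ψ ⊆ Ω := by
    intro y hy
    have : y ∈ Homeomorph.subRight (t • w) ⁻¹' tsupport φ := by
      rw [← tsupport_comp_eq_preimage]
      exact hy
    simpa using hw (y - t • w) (hφS this) t ⟨ht.1, ht.2.le⟩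
  have hgrad := h ψ hψ hψc hψs w
  have hfd : ∀ y, fderiv ℝ ψ y = fderiv ℝ φ (y - t • w) := fun y => by
    rw [hψdef, fderiv_comp_sub]
  simp only [hfd] at hgrad
  rw [hgrad, neg_neg]
  refine (abs_integral_inner_mul_le G w hψ hψc).trans (le_of_eq ?_)
  congr 2
  exact eLpNorm_comp_measurePreserving hφ.continuous.aestronglyMeasurable
    (measurePreserving_sub_right volume (t • w))

theorem lintegral_translate_sub_sq_le {Ω S : Set Plane} [IsFiniteMeasure (volume.restrict Ω)]
    (hΩ : IsOpen Ω) (hS : IsOpen S) {w : Plane}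
    (hw : ∀ x ∈ S, ∀ t ∈ Set.Icc (0 : ℝ) 1, x + t • w ∈ Ω) {u : L2 Ω} {G : L2Vec Ω}
    (h : IsWeakGradient Ω u G) :
    ∫⁻ x in S, ‖u (x + w) - u x‖ₑ ^ 2 ≤ ENNReal.ofReal ((‖w‖ * ‖G‖) ^ 2) := by
  rw [← eLpNorm_two_sq, ENNReal.ofReal_pow (by positivity)]
  gcongr
  exact eLpNorm_translate_sub_le hΩ hS hw h

/-- Substitute `y = x + v` with `‖v‖ < 2r`, exchange the integrals, and apply the translation
estimate for each fixed `v`. The segments from `x` to `x + v` stay in the ball of radius `3r`. -/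
theorem lintegral_lintegral_ball_sub_sq_le {Ω : Set Plane} [IsFiniteMeasure (volume.restrict Ω)]
    (hΩ : IsOpen Ω) {x₀ : Plane} {r : ℝ} (hB : Metric.ball x₀ (3 * r) ⊆ Ω)
    {u : L2 Ω} {G : L2Vec Ω} (h : IsWeakGradient Ω u G) :
    ∫⁻ x in Metric.ball x₀ r, ∫⁻ y in Metric.ball x₀ r, ‖u y - u x‖ₑ ^ 2 ≤
      ENNReal.ofReal ((2 * r * ‖G‖) ^ 2) * volume (Metric.ball (0 : Plane) (2 * r)) := by
  have hum : Measurable u := (Lp.stronglyMeasurable u).measurable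
  set B := Metric.ball x₀ r
  have step : ∀ x ∈ B, ∫⁻ y in B, ‖u y - u x‖ₑ ^ 2 ≤
      ∫⁻ v in Metric.ball (0 : Plane) (2 * r), ‖u (x + v) - u x‖ₑ ^ 2 := by
    intro x hx
    rw [← (measurePreserving_add_left (volume : Measure Plane) x).setLIntegral_comp_preimage_emb
      (measurableEmbedding_addLeft x) (fun y => ‖u y - u x‖ₑ ^ 2) B]
    refine lintegral_mono_set fun v hv => ?_
    have h1 : dist (x + v) x₀ < r := hv
    have h2 : dist x x₀ < r := hx
    rw [dist_eq_norm] at h1 h2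
    rw [mem_ball_zero_iff]
    calc ‖v‖ = ‖(x + v - x₀) - (x - x₀)‖ := by congr 1; abel
      _ ≤ ‖x + v - x₀‖ + ‖x - x₀‖ := norm_sub_le _ _
      _ < 2 * r := by linarith
  calc _ ≤ ∫⁻ x in B, ∫⁻ v in Metric.ball (0 : Plane) (2 * r), ‖u (x + v) - u x‖ₑ ^ 2 :=
        setLIntegral_mono' measurableSet_ball step
    _ = ∫⁻ v in Metric.ball (0 : Plane) (2 * r), ∫⁻ x in B, ‖u (x + v) - u x‖ₑ ^ 2 := by
        refine lintegral_lintegral_swap (Measurable.aemeasurable ?_)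
        simp only [Function.uncurry_def]
        fun_prop
    _ ≤ ∫⁻ v in Metric.ball (0 : Plane) (2 * r), ENNReal.ofReal ((2 * r * ‖G‖) ^ 2) := by
        refine setLIntegral_mono' measurableSet_ball fun v hv => ?_
        have hv' : ‖v‖ < 2 * r := mem_ball_zero_iff.1 hv
        refine (lintegral_translate_sub_sq_le hΩ Metric.isOpen_ball (w := v) ?_ h).trans ?_
        · intro x hx t ht
          apply hB
          have h2 : dist x x₀ < r := hx
          rw [Metric.mem_ball, dist_eq_norm] at *
          have h3 : ‖t • v‖ ≤ ‖v‖ := by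
            rw [norm_smul, Real.norm_of_nonneg ht.1]
            nlinarith [norm_nonneg v, ht.2]
          calc ‖x + t • v - x₀‖ = ‖(x - x₀) + t • v‖ := by congr 1; abel
            _ ≤ ‖x - x₀‖ + ‖t • v‖ := norm_add_le _ _
            _ < 3 * r := by linarith
        · gcongr
    _ = _ := by simp

/-! ### Poincaré inequality modulo finitely many functionals -/

/-- The double integral of squared differences. -/
theorem integral_integral_sub_sq {α : Type*} [MeasurableSpace α] {μ : Measure α}
    [IsFiniteMeasure μ] {u : α → ℝ} (hu : MemLp u 2 μ) :
    ∫⁻ x, ∫⁻ y, ‖u y - u x‖ₑ ^ 2 ∂μ ∂μ =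
      ENNReal.ofReal (2 * μ.real Set.univ * (∫ x, u x ^ 2 ∂μ) - 2 * (∫ x, u x ∂μ) ^ 2) := by
  have hu1 : Integrable u μ := hu.integrable (by norm_num)
  have hu2 : Integrable (fun x => u x ^ 2) μ := hu.integrable_sq
  have hexp : ∀ a b c : ℝ, Integrable (fun x => a + b * u x + c * u x ^ 2) μ ∧
      ∫ x, (a + b * u x + c * u x ^ 2) ∂μ =
        a * μ.real Set.univ + b * (∫ x, u x ∂μ) + c * ∫ x, u x ^ 2 ∂μ := by
    intro a b c
    have h0 : Integrable (fun _ => a : α → ℝ) μ := integrable_const a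
    have h1 : Integrable (fun x => b * u x) μ := hu1.const_mul b
    have h2 : Integrable (fun x => c * u x ^ 2) μ := hu2.const_mul c
    have h01 : Integrable (fun x => a + b * u x) μ := h0.add h1
    refine ⟨h01.add h2, ?_⟩
    rw [integral_add h01 h2, integral_add h0 h1, integral_const_mul, integral_const_mul,
      integral_const, smul_eq_mul, mul_comm a]
  have hnn : ∀ x y, 0 ≤ u x ^ 2 + (-2 * u x) * u y + 1 * u y ^ 2 := fun x y => by
    nlinarith [sq_nonneg (u y - u x)]
  have hinner : ∀ x, ∫⁻ y, ‖u y - u x‖ₑ ^ 2 ∂μ = ENNReal.ofReal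
      ((∫ y, u y ^ 2 ∂μ) + (-2 * ∫ y, u y ∂μ) * u x + μ.real Set.univ * u x ^ 2) := by
    intro x
    have h := hexp (u x ^ 2) (-2 * u x) 1
    rw [show (∫ y, u y ^ 2 ∂μ) + (-2 * ∫ y, u y ∂μ) * u x + μ.real Set.univ * u x ^ 2 =
      ∫ y, (u x ^ 2 + (-2 * u x) * u y + 1 * u y ^ 2) ∂μ by rw [h.2]; ring,
      ofReal_integral_eq_lintegral_ofReal h.1 (Filter.Eventually.of_forall (hnn x))]
    refine lintegral_congr fun y => ?_
    rw [Real.enorm_eq_ofReal_abs, ← ENNReal.ofReal_pow (abs_nonneg _), sq_abs]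
    congr 1; ring
  have hnn' : ∀ x, 0 ≤ (∫ y, u y ^ 2 ∂μ) + (-2 * ∫ y, u y ∂μ) * u x
      + μ.real Set.univ * u x ^ 2 := by
    intro x
    rw [show (∫ y, u y ^ 2 ∂μ) + (-2 * ∫ y, u y ∂μ) * u x + μ.real Set.univ * u x ^ 2 =
      ∫ y, (u x ^ 2 + (-2 * u x) * u y + 1 * u y ^ 2) ∂μ by
        rw [(hexp (u x ^ 2) (-2 * u x) 1).2]; ring]
    exact integral_nonneg (hnn x)
  simp only [hinner]
  have h := hexp (∫ y, u y ^ 2 ∂μ) (-2 * ∫ y, u y ∂μ) (μ.real Set.univ)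
  rw [← ofReal_integral_eq_lintegral_ofReal h.1 (Filter.Eventually.of_forall hnn'), h.2]
  congr 1
  ring

theorem two_mul_ofReal (a : ℝ) : 2 * ENNReal.ofReal a = ENNReal.ofReal (2 * a) := by
  rw [ENNReal.ofReal_mul (by norm_num), ENNReal.ofReal_ofNat]

theorem lintegral_enorm_sq_eq {α : Type*} [MeasurableSpace α] {μ : Measure α}
    {u : α → ℝ} (hu : MemLp u 2 μ) :
    ∫⁻ x, ‖u x‖ₑ ^ 2 ∂μ = ENNReal.ofReal (∫ x, u x ^ 2 ∂μ) := by
  rw [ofReal_integral_eq_lintegral_ofReal hu.integrable_sq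
    (Filter.Eventually.of_forall fun _ => sq_nonneg _)]
  refine lintegral_congr fun y => ?_
  rw [Real.enorm_eq_ofReal_abs, ← ENNReal.ofReal_pow (abs_nonneg _), sq_abs]

/-- On `T`, Sobolev functions are controlled in `L²` by their gradient and by finitely many
bounded linear functionals. -/
def PoincareOn (Ω T : Set Plane) : Prop :=
  ∃ (C : ℝ) (s : Finset (L2 Ω →L[ℝ] ℝ)), 0 ≤ C ∧ ∀ (u : L2 Ω) (G : L2Vec Ω),
    IsWeakGradient Ω u G →
      ∫⁻ x in T, ‖u x‖ₑ ^ 2 ≤ ENNReal.ofReal (C * (‖G‖ ^ 2 + ∑ l ∈ s, l u ^ 2))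

theorem PoincareOn.mono {Ω S T : Set Plane} (hST : S ⊆ T) (h : PoincareOn Ω T) :
    PoincareOn Ω S := by
  obtain ⟨C, s, hC, h⟩ := h
  exact ⟨C, s, hC, fun u G hu => (lintegral_mono_set hST).trans (h u G hu)⟩

/-- Merging the two finite sets of functionals makes the property stable under finite unions, as
induction over compact sets requires. -/
theorem PoincareOn.union {Ω S T : Set Plane} (hS : PoincareOn Ω S) (hT : PoincareOn Ω T) :
    PoincareOn Ω (S ∪ T) := by
  classical
  obtain ⟨C, s, hC, h⟩ := hS
  obtain ⟨C', s', hC', h'⟩ := hT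
  refine ⟨C + C', s ∪ s', by positivity, fun u G hu => ?_⟩
  refine (lintegral_union_le _ S T).trans ((add_le_add (h u G hu) (h' u G hu)).trans ?_)
  rw [← ENNReal.ofReal_add (by positivity) (by positivity), add_mul]
  have h1 : ∑ l ∈ s, l u ^ 2 ≤ ∑ l ∈ s ∪ s', l u ^ 2 :=
    Finset.sum_le_sum_of_subset_of_nonneg Finset.subset_union_left fun _ _ _ => sq_nonneg _
  have h2 : ∑ l ∈ s', l u ^ 2 ≤ ∑ l ∈ s ∪ s', l u ^ 2 :=
    Finset.sum_le_sum_of_subset_of_nonneg Finset.subset_union_right fun _ _ _ => sq_nonneg _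
  gcongr

theorem poincareOn_empty (Ω : Set Plane) : PoincareOn Ω ∅ :=
  ⟨0, ∅, le_rfl, fun u G _ => by simp⟩

/-- The double integral of squared differences is twice `V ∫ u² - (∫ u)²`, so the mean over the ball
is the only functional needed. -/
theorem poincareOn_ball {Ω : Set Plane} [IsFiniteMeasure (volume.restrict Ω)]
    (hΩ : IsOpen Ω) {x₀ : Plane} {r : ℝ} (hr : 0 < r) (hB : Metric.ball x₀ (3 * r) ⊆ Ω) :
    PoincareOn Ω (Metric.ball x₀ r) := by
  set B := Metric.ball x₀ r with hBdef
  have hBΩ : B ⊆ Ω := (Metric.ball_subset_ball (by linarith)).trans hB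
  have hBm : MeasurableSet B := measurableSet_ball
  set V := volume.real B with hV
  set V' := volume.real (Metric.ball (0 : Plane) (2 * r)) with hV'
  have hVpos : 0 < V := ENNReal.toReal_pos (Metric.measure_ball_pos _ _ hr).ne'
    measure_ball_lt_top.ne
  let l : L2 Ω →L[ℝ] ℝ := innerSL ℝ (indicatorConstLp 2 hBm
    (measure_ne_top (volume.restrict Ω) B) (1 : ℝ))
  have hl : ∀ u : L2 Ω, l u = ∫ x in B, u x := fun u => by
    have := L2.inner_indicatorConstLp_one (𝕜 := ℝ) hBm (measure_ne_top (volume.restrict Ω) B) u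
    rw [Measure.restrict_restrict hBm, Set.inter_eq_left.2 hBΩ] at this
    exact this
  refine ⟨(2 * r) ^ 2 * V' / V + 1 / V, {l}, by positivity, fun u G h => ?_⟩
  have hu2 : MemLp u 2 (volume.restrict B) :=
    (Lp.memLp u).mono_measure (Measure.restrict_mono hBΩ le_rfl)
  have key := lintegral_lintegral_ball_sub_sq_le hΩ hB h
  have : IsFiniteMeasure (volume.restrict B) := isFiniteMeasure_restrict.2 measure_ball_lt_top.ne
  rw [integral_integral_sub_sq hu2, ← ENNReal.ofReal_toReal (measure_ball_lt_top
    (μ := volume) (x := (0 : Plane)) (r := 2 * r)).ne, ← ENNReal.ofReal_mul (by positivity),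
    ENNReal.ofReal_le_ofReal_iff (by positivity)] at key
  rw [lintegral_enorm_sq_eq hu2, Finset.sum_singleton, hl]
  apply ENNReal.ofReal_le_ofReal
  have hVu : (volume.restrict B).real Set.univ = V := by simp [hV]
  rw [hVu] at key
  change _ ≤ (2 * r * ‖G‖) ^ 2 * V' at key
  set q := ∫ x in B, u x ^ 2
  set m := ∫ x in B, u x
  have hV'0 : 0 ≤ V' := measureReal_nonneg
  -- Half of the gradient term is given away; division by `V` then explains both summands of the
  -- chosen constant.
  have h1 : V * q ≤ (2 * r) ^ 2 * V' * ‖G‖ ^ 2 + m ^ 2 := by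
    have : 0 ≤ (2 * r * ‖G‖) ^ 2 * V' := by positivity
    nlinarith
  have h2 : q ≤ ((2 * r) ^ 2 * V' * ‖G‖ ^ 2 + m ^ 2) / V := by
    rw [le_div_iff₀ hVpos]; linarith
  have h3 : ((2 * r) ^ 2 * V' / V + 1 / V) * (‖G‖ ^ 2 + m ^ 2) =
      ((2 * r) ^ 2 * V' * ‖G‖ ^ 2 + m ^ 2) / V + ((2 * r) ^ 2 * V' / V * m ^ 2 + ‖G‖ ^ 2 / V) := by
    field_simp; ring
  rw [h3]
  have : 0 ≤ (2 * r) ^ 2 * V' / V * m ^ 2 + ‖G‖ ^ 2 / V := by positivity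
  linarith

theorem exists_ball_three_mul_subset {Ω : Set Plane} (hΩ : IsOpen Ω) {x : Plane} (hx : x ∈ Ω) :
    ∃ r : ℝ, 0 < r ∧ Metric.ball x (3 * r) ⊆ Ω := by
  obtain ⟨ε, hε, h⟩ := Metric.isOpen_iff.1 hΩ x hx
  exact ⟨ε / 3, by positivity, by convert h using 2; ring⟩

theorem poincareOn_of_isCompact {Ω : Set Plane} [IsFiniteMeasure (volume.restrict Ω)]
    (hΩ : IsOpen Ω) {T : Set Plane} (hT : IsCompact T) (hTΩ : T ⊆ Ω) : PoincareOn Ω T := by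
  refine hT.induction_on (p := PoincareOn Ω) (poincareOn_empty Ω) (fun _ _ h hT => hT.mono h)
    (fun _ _ => .union) fun x hx => ?_
  obtain ⟨r, hr, h⟩ := exists_ball_three_mul_subset hΩ (hTΩ hx)
  exact ⟨_, mem_nhdsWithin_of_mem_nhds (Metric.ball_mem_nhds x hr), poincareOn_ball hΩ hr h⟩

/-- Translating a piece of `Ω` into a compact subset of `Ω`. -/
theorem poincareOn_of_translate {Ω S : Set Plane} [IsFiniteMeasure (volume.restrict Ω)]
    (hΩ : IsOpen Ω) (hS : IsOpen S) (hSb : Bornology.IsBounded S) {w : Plane}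
    (hw : ∀ x ∈ S, ∀ t ∈ Set.Icc (0 : ℝ) 1, x + t • w ∈ Ω)
    (hcl : ∀ x ∈ closure S, x + w ∈ Ω) : PoincareOn Ω S := by
  have hK : IsCompact ((fun x => x + w) '' closure S) :=
    hSb.isCompact_closure.image (by fun_prop)
  obtain ⟨C, s, hC, h⟩ := poincareOn_of_isCompact hΩ hK (by rintro _ ⟨x, hx, rfl⟩; exact hcl x hx)
  refine ⟨2 * C + 2 * ‖w‖ ^ 2, s, by positivity, fun u G hu => ?_⟩
  have hum : Measurable u := (Lp.stronglyMeasurable u).measurable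
  -- The first term is integrated over a compact translate inside `Ω`, the second is the translation
  -- estimate; this gives the constants `2 * C` and `2 * ‖w‖ ^ 2`.
  have hpt : ∀ x, ‖u x‖ₑ ^ 2 ≤ 2 * ‖u (x + w)‖ₑ ^ 2 + 2 * ‖u (x + w) - u x‖ₑ ^ 2 := by
    intro x
    have e : ∀ a : ℝ, ‖a‖ₑ ^ 2 = ENNReal.ofReal (a ^ 2) := fun a => by
      rw [Real.enorm_eq_ofReal_abs, ← ENNReal.ofReal_pow (abs_nonneg _), sq_abs]
    rw [e, e, e, two_mul_ofReal, two_mul_ofReal, ← ENNReal.ofReal_add (by positivity) (by positivity)]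
    apply ENNReal.ofReal_le_ofReal
    nlinarith [sq_nonneg (2 * u (x + w) - u x)]
  have hshift : ∫⁻ x in S, ‖u (x + w)‖ₑ ^ 2 ≤
      ENNReal.ofReal (C * (‖G‖ ^ 2 + ∑ l ∈ s, l u ^ 2)) := by
    refine le_trans ?_ (h u G hu)
    rw [← (measurePreserving_add_right (volume : Measure Plane) w).setLIntegral_comp_preimage_emb
      (measurableEmbedding_addRight w) (fun y => ‖u y‖ₑ ^ 2)]
    exact lintegral_mono_set fun x hx => ⟨x, subset_closure hx, rfl⟩
  calc ∫⁻ x in S, ‖u x‖ₑ ^ 2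
      ≤ ∫⁻ x in S, (2 * ‖u (x + w)‖ₑ ^ 2 + 2 * ‖u (x + w) - u x‖ₑ ^ 2) := lintegral_mono hpt
    _ = 2 * (∫⁻ x in S, ‖u (x + w)‖ₑ ^ 2) + 2 * ∫⁻ x in S, ‖u (x + w) - u x‖ₑ ^ 2 := by
        rw [lintegral_add_left (by fun_prop), lintegral_const_mul _ (by fun_prop),
          lintegral_const_mul _ (by fun_prop)]
    _ ≤ 2 * ENNReal.ofReal (C * (‖G‖ ^ 2 + ∑ l ∈ s, l u ^ 2))
        + 2 * ENNReal.ofReal ((‖w‖ * ‖G‖) ^ 2) := by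
        gcongr
        exact lintegral_translate_sub_sq_le hΩ hS hw hu
    _ ≤ _ := by
        have hs0 : 0 ≤ ∑ l ∈ s, l u ^ 2 := Finset.sum_nonneg fun _ _ => sq_nonneg _
        rw [two_mul_ofReal, two_mul_ofReal, ← ENNReal.ofReal_add (by positivity) (by positivity)]
        apply ENNReal.ofReal_le_ofReal
        have : 0 ≤ ‖w‖ ^ 2 * ∑ l ∈ s, l u ^ 2 := by positivity
        nlinarith

/-- Moving along the vertical direction `e` of the graph coordinates keeps points of `Ω` above the
graph, and lifts limit points, which lie on or above it, strictly above. With ball radius and shift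
both `r / 4`, everything stays in the ball of radius `r` where the graph describes `Ω`. -/
theorem exists_poincareOn_frontier {Ω : Set Plane} [IsFiniteMeasure (volume.restrict Ω)]
    (hΩ : IsOpen Ω) (hL : HasLipschitzBoundary Ω) {x : Plane} (hx : x ∈ frontier Ω) :
    ∃ ρ : ℝ, 0 < ρ ∧ PoincareOn Ω (Metric.ball x ρ ∩ Ω) := by
  obtain ⟨r, hr, R, K, γ, hγ, hloc⟩ := hL x hx
  set e : Plane := R.symm (EuclideanSpace.single 1 1) with he
  have hRe0 : ∀ (y : Plane) (t : ℝ), R (y + t • e) 0 = R y 0 := fun y t => by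
    simp [he]
  have hRe1 : ∀ (y : Plane) (t : ℝ), R (y + t • e) 1 = R y 1 + t := fun y t => by
    simp [he]
  have hen : ‖e‖ = 1 := by simp [he]
  have hball : ∀ y ∈ Metric.closedBall x (r / 4), ∀ t ∈ Set.Icc (0 : ℝ) (r / 4),
      y + t • e ∈ Metric.ball x r := by
    intro y hy t ht
    rw [Metric.mem_ball, Metric.mem_closedBall, dist_eq_norm] at *
    calc ‖y + t • e - x‖ = ‖(y - x) + t • e‖ := by congr 1; abel
      _ ≤ ‖y - x‖ + ‖t • e‖ := norm_add_le _ _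
      _ = ‖y - x‖ + t := by rw [norm_smul, hen, mul_one, Real.norm_of_nonneg ht.1]
      _ < r := by linarith [ht.2]
  have hmem : ∀ y ∈ Metric.ball x r, (y ∈ Ω ↔ γ (R y 0) < R y 1) := by
    intro y hy
    have := Set.ext_iff.1 hloc y
    simp only [Set.mem_inter_iff, hy, and_true] at this
    exact this
  have hsub : Metric.ball x (r / 4) ⊆ Metric.ball x r := Metric.ball_subset_ball (by linarith)
  refine ⟨r / 4, by positivity, poincareOn_of_translate hΩ (Metric.isOpen_ball.inter hΩ)
    (Metric.isBounded_ball.subset Set.inter_subset_left) (w := (r / 4) • e) ?_ ?_⟩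
  · rintro y ⟨hy, hyΩ⟩ t ht
    rw [smul_smul]
    have hb := hball y (Metric.ball_subset_closedBall hy) (t * (r / 4))
      ⟨mul_nonneg ht.1 (by positivity), mul_le_of_le_one_left (by positivity) ht.2⟩
    rw [hmem _ hb, hRe0, hRe1]
    have := (hmem y (hsub hy)).1 hyΩ
    have : 0 ≤ t * (r / 4) := mul_nonneg ht.1 (by positivity)
    linarith
  · intro y hy
    have hcl : y ∈ Metric.closedBall x (r / 4) ∩ {y | γ (R y 0) ≤ R y 1} := by
      refine closure_minimal ?_ (Metric.isClosed_closedBall.inter (isClosed_le ?_ ?_)) hy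
      · rintro z ⟨hz, hzΩ⟩
        exact ⟨Metric.ball_subset_closedBall hz, ((hmem z (hsub hz)).1 hzΩ).le⟩
      · exact hγ.continuous.comp (by fun_prop)
      · fun_prop
    have hb := hball y hcl.1 (r / 4) ⟨by positivity, le_rfl⟩
    rw [hmem _ hb, hRe0, hRe1]
    have : γ (R y 0) ≤ R y 1 := hcl.2
    linarith

theorem isFiniteMeasure_restrict_of_isBounded {Ω : Set Plane} (hb : Bornology.IsBounded Ω) :
    IsFiniteMeasure (volume.restrict Ω) :=
  isFiniteMeasure_restrict.2 hb.measure_lt_top.ne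

/-- A Poincaré inequality modulo finitely many linear functionals. -/
theorem poincareOn_self {Ω : Set Plane} (hb : Bornology.IsBounded Ω) (hΩ : IsOpen Ω)
    (hL : HasLipschitzBoundary Ω) : PoincareOn Ω Ω := by
  have := isFiniteMeasure_restrict_of_isBounded hb
  have : PoincareOn Ω (closure Ω ∩ Ω) := by
    refine hb.isCompact_closure.induction_on (p := fun T => PoincareOn Ω (T ∩ Ω))
      (by simpa using poincareOn_empty Ω) (fun _ _ h hT => hT.mono (Set.inter_subset_inter_left _ h))
      (fun S T hS hT => by rw [Set.union_inter_distrib_right]; exact hS.union hT) fun x hx => ?_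
    by_cases hxΩ : x ∈ Ω
    · obtain ⟨r, hr, h⟩ := exists_ball_three_mul_subset hΩ hxΩ
      exact ⟨_, mem_nhdsWithin_of_mem_nhds (Metric.ball_mem_nhds x hr),
        (poincareOn_ball hΩ hr h).mono Set.inter_subset_left⟩
    · obtain ⟨ρ, hρ, h⟩ := exists_poincareOn_frontier hΩ hL
        (show x ∈ frontier Ω by rw [hΩ.frontier_eq]; exact ⟨hx, hxΩ⟩)
      exact ⟨_, mem_nhdsWithin_of_mem_nhds (Metric.ball_mem_nhds x hρ), h⟩
  exact this.mono (Set.subset_inter subset_closure subset_rfl)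

theorem exists_norm_sq_le {Ω : Set Plane} (hb : Bornology.IsBounded Ω) (hΩ : IsOpen Ω)
    (hL : HasLipschitzBoundary Ω) :
    ∃ (C : ℝ) (s : Finset (L2 Ω →L[ℝ] ℝ)), 0 ≤ C ∧ ∀ (u : L2 Ω) (G : L2Vec Ω),
      IsWeakGradient Ω u G → ‖u‖ ^ 2 ≤ C * (‖G‖ ^ 2 + ∑ l ∈ s, l u ^ 2) := by
  obtain ⟨C, s, hC, h⟩ := poincareOn_self hb hΩ hL
  refine ⟨C, s, hC, fun u G hu => ?_⟩
  have hs0 : 0 ≤ ∑ l ∈ s, l u ^ 2 := Finset.sum_nonneg fun _ _ => sq_nonneg _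
  have := h u G hu
  rw [← eLpNorm_two_sq, ← ENNReal.ofReal_toReal (Lp.eLpNorm_ne_top u), ← Lp.norm_def,
    ← ENNReal.ofReal_pow (norm_nonneg _), ENNReal.ofReal_le_ofReal_iff (by positivity)] at this
  exact this

/-! ### Vanishing gradient and compactness -/

/-- On a connected open set, a function with vanishing weak gradient is constant. -/
theorem exists_ae_eq_const_of_mem_kerGrad {Ω : Set Plane} (hb : Bornology.IsBounded Ω)
    (hΩ : IsOpen Ω) (hconn : IsConnected Ω) {u : L2 Ω} (hu : u ∈ kerGrad Ω) :
    ∃ c : ℝ, ∀ᵐ x ∂volume.restrict Ω, u x = c := by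
  have := isFiniteMeasure_restrict_of_isBounded hb
  have hum : Measurable u := (Lp.stronglyMeasurable u).measurable
  have hloc : ∀ x ∈ Ω, ∃ r : ℝ, 0 < r ∧ Metric.ball x r ⊆ Ω ∧
      ∃ c : ℝ, ∀ᵐ y ∂volume.restrict (Metric.ball x r), u y = c := by
    intro x hx
    obtain ⟨r, hr, h⟩ := exists_ball_three_mul_subset hΩ hx
    refine ⟨r, hr, (Metric.ball_subset_ball (by linarith)).trans h, ?_⟩
    -- With zero gradient the double integral of squared differences vanishes, so `u` equals its
    -- value at almost any point `z` of the ball.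
    have := lintegral_lintegral_ball_sub_sq_le hΩ h (G := 0) hu
    simp only [norm_zero, mul_zero, ne_eq, OfNat.ofNat_ne_zero, not_false_eq_true, zero_pow,
      ENNReal.ofReal_zero, zero_mul, nonpos_iff_eq_zero] at this
    rw [lintegral_eq_zero_iff (by fun_prop)] at this
    have hne : (ae (volume.restrict (Metric.ball x r))).NeBot := by
      rw [ae_neBot, Ne, Measure.restrict_eq_zero]
      exact (Metric.measure_ball_pos _ _ hr).ne'
    obtain ⟨z, hz⟩ := this.exists
    rw [Pi.zero_apply, lintegral_eq_zero_iff (by fun_prop)] at hz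
    refine ⟨u z, ?_⟩
    filter_upwards [hz] with y hy
    simpa [sub_eq_zero] using hy
  choose! r hr hrΩ c hc using hloc
  have hcc : ∀ x ∈ Ω, ∀ y ∈ Metric.ball x (r x), c y = c x := by
    intro x hx y hy
    have hyΩ := hrΩ x hx hy
    set U := Metric.ball x (r x) ∩ Metric.ball y (r y) with hU
    have hUo : IsOpen U := Metric.isOpen_ball.inter Metric.isOpen_ball
    have hUne : U.Nonempty := ⟨y, hy, Metric.mem_ball_self (hr y hyΩ)⟩
    have : (ae (volume.restrict U)).NeBot := by
      rw [ae_neBot, Ne, Measure.restrict_eq_zero]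
      exact (hUo.measure_pos volume hUne).ne'
    obtain ⟨z, h1, h2⟩ := ((ae_restrict_of_ae_restrict_of_subset Set.inter_subset_left
      (hc x hx)).and (ae_restrict_of_ae_restrict_of_subset Set.inter_subset_right
      (hc y hyΩ)) : ∀ᵐ z ∂volume.restrict U, u z = c x ∧ u z = c y).exists
    rw [← h1, ← h2]
  obtain ⟨x₀, hx₀⟩ := hconn.nonempty
  have hconst : ∀ x ∈ Ω, c x = c x₀ := by
    -- The local constant `c` is locally constant, so each condition on it cuts out an open set, and
    -- connectedness forbids a second value.
    have hopen : ∀ p : ℝ → Prop, IsOpen {x | x ∈ Ω ∧ p (c x)} := by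
      intro p
      rw [Metric.isOpen_iff]
      rintro x ⟨hx, hpx⟩
      exact ⟨r x, hr x hx, fun y hy => ⟨hrΩ x hx hy, by rwa [hcc x hx y hy]⟩⟩
    by_contra! hne
    obtain ⟨x₁, hx₁, hne⟩ := hne
    obtain ⟨z, _, hz1, hz2⟩ := hconn.isPreconnected _ _ (hopen (· = c x₀)) (hopen (· ≠ c x₀))
      (fun x hx => by
        by_cases h : c x = c x₀
        · exact Or.inl ⟨hx, h⟩
        · exact Or.inr ⟨hx, h⟩) ⟨x₀, hx₀, hx₀, rfl⟩ ⟨x₁, hx₁, hx₁, hne⟩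
    exact hz2.2 hz1.2
  refine ⟨c x₀, ?_⟩
  rw [ae_restrict_iff' hΩ.measurableSet, ae_iff]
  refine measure_null_of_locally_null _ fun x hx => ?_
  have hxΩ : x ∈ Ω := by
    by_contra h
    exact hx fun h' => absurd h' h
  have h1 := hc x hxΩ
  rw [ae_restrict_iff' measurableSet_ball, ae_iff, hconst x hxΩ] at h1
  refine ⟨_ ∩ Metric.ball x (r x), Filter.inter_mem self_mem_nhdsWithin
    (mem_nhdsWithin_of_mem_nhds (Metric.ball_mem_nhds x (hr x hxΩ))), measure_mono_null ?_ h1⟩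
  rintro y ⟨hy, hyb⟩ h
  exact hy fun _ => h hyb

/-- A bounded sequence whose weak gradients converge strongly has a strongly convergent
subsequence. -/
theorem exists_subseq_tendsto {Ω : Set Plane} (hb : Bornology.IsBounded Ω) (hΩ : IsOpen Ω)
    (hL : HasLipschitzBoundary Ω) {u : ℕ → L2 Ω} {G : ℕ → L2Vec Ω}
    (h : ∀ n, IsWeakGradient Ω (u n) (G n)) {M : ℝ} (hM : ∀ n, ‖u n‖ ≤ M) (hG : CauchySeq G) :
    ∃ (φ : ℕ → ℕ) (u₀ : L2 Ω), StrictMono φ ∧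
      Filter.Tendsto (u ∘ φ) Filter.atTop (nhds u₀) := by
  obtain ⟨C, s, hC, hP⟩ := exists_norm_sq_le hb hΩ hL
  -- Bolzano–Weierstrass makes the finitely many functionals converge along a subsequence; the
  -- Poincaré bound applied to differences then gives a Cauchy sequence.
  let L : L2 Ω →L[ℝ] (s → ℝ) := ContinuousLinearMap.pi fun l => l.1
  have hLb : ∀ n, L (u n) ∈ Metric.closedBall (0 : s → ℝ) (‖L‖ * M) := fun n => by
    rw [mem_closedBall_zero_iff]
    exact (L.le_opNorm _).trans (by gcongr; exact hM n)
  obtain ⟨a, -, φ, hφ, ha⟩ := tendsto_subseq_of_bounded Metric.isBounded_closedBall hLb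
  have hcau : CauchySeq (u ∘ φ) := by
    rw [cauchySeq_iff_tendsto_dist_atTop_0]
    have hG' : CauchySeq (G ∘ φ) := hG.comp_tendsto hφ.tendsto_atTop
    rw [cauchySeq_iff_tendsto_dist_atTop_0] at hG'
    have hl : ∀ l ∈ s, Filter.Tendsto (fun p : ℕ × ℕ => (l (u (φ p.1) - u (φ p.2))) ^ 2)
        Filter.atTop (nhds 0) := by
      intro l hl
      have h1 : CauchySeq (fun n => l (u (φ n))) :=
        (((continuous_apply (⟨l, hl⟩ : s)).tendsto a).comp ha).cauchySeq
      rw [cauchySeq_iff_tendsto_dist_atTop_0] at h1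
      have := h1.pow 2
      simpa [Real.dist_eq, sq_abs] using this
    have hsum := tendsto_finsetSum s hl
    have hbd := ((hG'.pow 2).add hsum).const_mul C
    simp only [ne_eq, OfNat.ofNat_ne_zero, not_false_eq_true, zero_pow, Finset.sum_const_zero,
      add_zero, mul_zero] at hbd
    have hsq : Filter.Tendsto (fun p : ℕ × ℕ => dist ((u ∘ φ) p.1) ((u ∘ φ) p.2) ^ 2)
        Filter.atTop (nhds 0) := by
      refine squeeze_zero (fun p => sq_nonneg _) (fun p => ?_) hbd
      rw [dist_eq_norm, dist_eq_norm]
      exact hP _ _ ((h _).sub (h _))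
    have := hsq.sqrt
    simpa [Real.sqrt_sq dist_nonneg] using this
  obtain ⟨u₀, hu₀⟩ := cauchySeq_tendsto_of_complete hcau
  exact ⟨φ, u₀, hφ, hu₀⟩

/-! ### Semicontinuity of the fidelity and coercivity -/

/-- The fidelity term `∫_{Ω₀} ψ(f, 𝒜u)` of a nonnegative extended real integrand. -/
noncomputable def fid {Ω : Set Plane} (Ω₀ : Set Plane) (A : L2 Ω →L[ℝ] L2 Ω)
    (ψ : ℝ → ℝ → ℝ≥0∞) (f u : L2 Ω) : ℝ≥0∞ := ∫⁻ x in Ω₀, ψ (f x) (A u x)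

theorem measurable_fid_integrand {Ω : Set Plane} {ψ : ℝ → ℝ → ℝ≥0∞}
    (hψ : Measurable (Function.uncurry ψ)) (f u : L2 Ω) : Measurable fun x => ψ (f x) (u x) :=
  hψ.comp ((Lp.stronglyMeasurable f).measurable.prodMk (Lp.stronglyMeasurable u).measurable)

/-- Strong `L²` convergence gives almost everywhere convergence of `𝒜u` along a subsequence;
pointwise semicontinuity and Fatou do the rest. -/
theorem exists_subseq_fid_le_liminf {Ω Ω₀ : Set Plane} (hsub : Ω₀ ⊆ Ω) (A : L2 Ω →L[ℝ] L2 Ω)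
    {ψ : ℝ → ℝ → ℝ≥0∞} (hψ : Measurable (Function.uncurry ψ)) {f : L2 Ω}
    (hlsc : ∀ᵐ x ∂volume.restrict Ω₀, LowerSemicontinuous (ψ (f x)))
    {u : ℕ → L2 Ω} {u₀ : L2 Ω} (hu : Filter.Tendsto u Filter.atTop (nhds u₀)) :
    ∃ ns : ℕ → ℕ, StrictMono ns ∧ fid Ω₀ A ψ f u₀ ≤
      Filter.liminf (fun k => fid Ω₀ A ψ f (u (ns k))) Filter.atTop := by
  have hA := (A.continuous.tendsto u₀).comp hu
  obtain ⟨ns, hns, hae⟩ := (tendstoInMeasure_of_tendsto_Lp hA).exists_seq_tendsto_ae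
  refine ⟨ns, hns, le_trans ?_ (lintegral_liminf_le
    fun k => measurable_fid_integrand hψ f (A (u (ns k))))⟩
  refine lintegral_mono_ae ?_
  filter_upwards [ae_restrict_of_ae_restrict_of_subset hsub hae, hlsc] with x hx hl
  refine (lowerSemicontinuousAt_iff_le_liminf.1 (hl (A u₀ x))).trans ?_
  exact Filter.liminf_le_liminf_of_le hx

theorem mem_kerMasked_iff {Ω Ω₀ : Set Plane} (hΩ : IsOpen Ω) (hΩ₀ : IsOpen Ω₀) (hsub : Ω₀ ⊆ Ω)
    (A : L2 Ω →L[ℝ] L2 Ω) (u : L2 Ω) :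
    u ∈ kerMasked Ω Ω₀ A ↔ ∀ᵐ x ∂volume.restrict Ω₀, A u x = 0 := by
  rw [ae_restrict_iff' hΩ₀.measurableSet, kerMasked, Set.mem_ofPred_eq,
    ae_restrict_iff' hΩ.measurableSet]
  refine Filter.eventually_congr (Filter.Eventually.of_forall fun x => ?_)
  by_cases hx : x ∈ Ω₀
  · simp [hx, hsub hx]
  · simp [hx]

theorem measurable_uncurry_enorm_snd :
    Measurable (Function.uncurry fun _ t : ℝ => ‖t‖ₑ) :=
  measurable_enorm.comp measurable_snd

/-- Sobolev functions are controlled by their gradient and by the masked image `ω𝒜u` in `L¹`. -/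
theorem exists_norm_le {Ω Ω₀ : Set Plane} (hb : Bornology.IsBounded Ω) (hΩ : IsOpen Ω)
    (hL : HasLipschitzBoundary Ω) (hΩ₀ : IsOpen Ω₀) (hsub : Ω₀ ⊆ Ω) (A : L2 Ω →L[ℝ] L2 Ω)
    (hker : kerMasked Ω Ω₀ A ∩ kerGrad Ω = {0}) :
    ∃ C : ℝ, ∀ (u : L2 Ω) (G : L2Vec Ω) (P : ℝ), IsWeakGradient Ω u G → 0 ≤ P →
      ∫⁻ x in Ω₀, ‖A u x‖ₑ ≤ ENNReal.ofReal P → ‖u‖ ≤ C * (P + ‖G‖) := by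
  by_contra! hcon
  -- Violating the bound with constants `n + 1` and normalizing gives unit vectors whose gradients
  -- and masked images tend to `0`. A strong limit has norm `1` and lies in both kernels.
  choose u G P hu hP hle hlt using fun n : ℕ => hcon ((n : ℝ) + 1)
  have hpos : ∀ n, 0 < ‖u n‖ := fun n =>
    lt_of_le_of_lt (by have := hP n; positivity) (hlt n)
  set v : ℕ → L2 Ω := fun n => ‖u n‖⁻¹ • u n with hv
  set H : ℕ → L2Vec Ω := fun n => ‖u n‖⁻¹ • G n with hH
  have hvH : ∀ n, IsWeakGradient Ω (v n) (H n) := fun n => (hu n).smul _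
  have hvn : ∀ n, ‖v n‖ = 1 := fun n => by
    rw [hv, norm_smul, norm_inv, norm_norm, inv_mul_cancel₀ (hpos n).ne']
  have hsum : ∀ n, ‖u n‖⁻¹ * P n + ‖H n‖ ≤ 1 / ((n : ℝ) + 1) := fun n => by
    rw [hH, norm_smul, norm_inv, norm_norm, ← mul_add, le_div_iff₀ (by positivity),
      inv_mul_eq_div, div_mul_eq_mul_div, div_le_one (hpos n), mul_comm]
    exact (hlt n).le
  have hlim := tendsto_one_div_add_atTop_nhds_zero_nat (𝕜 := ℝ)
  have hH0 : Filter.Tendsto H Filter.atTop (nhds 0) := by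
    refine squeeze_zero_norm (fun n => ?_) hlim
    have : 0 ≤ ‖u n‖⁻¹ * P n := mul_nonneg (by positivity) (hP n)
    linarith [hsum n]
  obtain ⟨φ, v₀, hφ, hv₀⟩ := exists_subseq_tendsto hb hΩ hL hvH (fun n => (hvn n).le)
    hH0.cauchySeq
  have hgrad : v₀ ∈ kerGrad Ω := isWeakGradient_of_tendsto (fun n => hvH (φ n)) hv₀
    (hH0.comp hφ.tendsto_atTop)
  have hfid : ∀ n, fid Ω₀ A (fun _ t => ‖t‖ₑ) 0 (v n) ≤ ENNReal.ofReal (1 / ((n : ℝ) + 1)) := by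
    intro n
    have h1 : fid Ω₀ A (fun _ t => ‖t‖ₑ) 0 (v n) =
        ENNReal.ofReal (‖u n‖⁻¹) * ∫⁻ x in Ω₀, ‖A (u n) x‖ₑ := by
      rw [fid, ← lintegral_const_mul _ (Lp.stronglyMeasurable _).measurable.enorm]
      refine lintegral_congr_ae ?_
      have := Lp.coeFn_smul ‖u n‖⁻¹ (A (u n))
      filter_upwards [ae_restrict_of_ae_restrict_of_subset hsub this] with x hx
      rw [hv, map_smul, hx, Pi.smul_apply, enorm_smul, Real.enorm_eq_ofReal (by positivity)]
    rw [h1]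
    calc _ ≤ ENNReal.ofReal (‖u n‖⁻¹) * ENNReal.ofReal (P n) := by gcongr; exact hle n
      _ = ENNReal.ofReal (‖u n‖⁻¹ * P n) := (ENNReal.ofReal_mul (by positivity)).symm
      _ ≤ _ := ENNReal.ofReal_le_ofReal (by linarith [hsum n, norm_nonneg (H n)])
  have hmask : v₀ ∈ kerMasked Ω Ω₀ A := by
    rw [mem_kerMasked_iff hΩ hΩ₀ hsub]
    obtain ⟨ns, hns, hlim'⟩ := exists_subseq_fid_le_liminf (f := 0) hsub A
      measurable_uncurry_enorm_snd (Filter.Eventually.of_forall fun x =>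
        (continuous_enorm : Continuous fun t : ℝ => ‖t‖ₑ).lowerSemicontinuous) hv₀
    have h0 : Filter.Tendsto (fun k => fid Ω₀ A (fun _ t => ‖t‖ₑ) 0 ((v ∘ φ) (ns k)))
        Filter.atTop (nhds 0) := by
      refine tendsto_of_tendsto_of_tendsto_of_le_of_le tendsto_const_nhds ?_
        (fun _ => zero_le) (fun k => hfid _)
      have := (ENNReal.tendsto_ofReal hlim).comp (hφ.tendsto_atTop.comp hns.tendsto_atTop)
      rw [ENNReal.ofReal_zero] at this
      exact this
    rw [h0.liminf_eq, nonpos_iff_eq_zero, fid,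
      lintegral_eq_zero_iff (Lp.stronglyMeasurable _).measurable.enorm] at hlim'
    filter_upwards [hlim'] with x hx
    simpa using hx
  have h0 : v₀ = 0 := by
    have : v₀ ∈ kerMasked Ω Ω₀ A ∩ kerGrad Ω := ⟨hmask, hgrad⟩
    rwa [hker] at this
  have hn : ‖v₀‖ = 1 := tendsto_nhds_unique hv₀.norm (by simp [hvn])
  rw [h0, norm_zero] at hn
  exact zero_ne_one hn

/-! ### Convexity of the gradient part -/

theorem integral_norm_sq_eq {Ω : Set Plane} (G : L2Vec Ω) : ∫ x in Ω, ‖G x‖ ^ 2 = ‖G‖ ^ 2 := by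
  rw [← real_inner_self_eq_norm_sq, L2.inner_def]
  simp only [real_inner_self_eq_norm_sq]

theorem integrable_norm_L2Vec {Ω : Set Plane} [IsFiniteMeasure (volume.restrict Ω)]
    (G : L2Vec Ω) : Integrable (fun x => ‖G x‖) (volume.restrict Ω) :=
  ((Lp.memLp G).integrable (by norm_num)).norm

/-- On a finite measure space Hölder bounds the `L¹` norm by the `L²` norm, so the map is Lipschitz,
with constant `c`, the square root of the measure of `Ω`. -/
theorem continuous_integral_norm {Ω : Set Plane} [IsFiniteMeasure (volume.restrict Ω)] :
    Continuous fun G : L2Vec Ω => ∫ x in Ω, ‖G x‖ := by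
  set c : ℝ := ((volume.restrict Ω) Set.univ ^ (1 / (1 : ℝ≥0∞).toReal - 1 / (2 : ℝ≥0∞).toReal)).toReal
  have hbd : ∀ G : L2Vec Ω, ∫ x in Ω, ‖G x‖ ≤ ‖G‖ * c := by
    intro G
    have h := eLpNorm_le_eLpNorm_mul_rpow_measure_univ (p := 1) (q := 2) (by norm_num)
      (Lp.aestronglyMeasurable G)
    rw [integral_norm_eq_lintegral_enorm (Lp.aestronglyMeasurable G),
      ← eLpNorm_one_eq_lintegral_enorm, Lp.norm_def, ← ENNReal.toReal_mul]
    refine ENNReal.toReal_mono (ENNReal.mul_ne_top (Lp.eLpNorm_ne_top G) ?_) h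
    exact ENNReal.rpow_ne_top_of_nonneg (by norm_num) (measure_ne_top _ _)
  have hsub : ∀ G H : L2Vec Ω, (∫ x in Ω, ‖G x‖) - ∫ x in Ω, ‖H x‖ ≤ ‖G - H‖ * c := by
    intro G H
    refine le_trans ?_ (hbd (G - H))
    rw [← integral_sub (integrable_norm_L2Vec G) (integrable_norm_L2Vec H)]
    refine integral_mono_ae ((integrable_norm_L2Vec G).sub (integrable_norm_L2Vec H))
      (integrable_norm_L2Vec _) ?_
    filter_upwards [Lp.coeFn_sub G H] with x hx
    rw [hx]
    exact norm_sub_norm_le _ _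
  refine LipschitzWith.continuous (K := ⟨c, ENNReal.toReal_nonneg⟩)
    (LipschitzWith.of_dist_le_mul fun G H => ?_)
  rw [Real.dist_eq, dist_eq_norm, abs_sub_le_iff, mul_comm]
  refine ⟨hsub G H, ?_⟩
  rw [norm_sub_rev]
  exact hsub H G

/-- The part `(μ/2)∫|G|² + ∫|G|` of the energy. -/
noncomputable def gradPart {Ω : Set Plane} (mu : ℝ) (G : L2Vec Ω) : ℝ :=
  mu / 2 * ‖G‖ ^ 2 + ∫ x in Ω, ‖G x‖

theorem gradPart_nonneg {Ω : Set Plane} {mu : ℝ} (hmu : 0 < mu) (G : L2Vec Ω) :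
    0 ≤ gradPart mu G :=
  add_nonneg (by positivity) (integral_nonneg fun _ => norm_nonneg _)

theorem continuous_gradPart {Ω : Set Plane} [IsFiniteMeasure (volume.restrict Ω)] (mu : ℝ) :
    Continuous (gradPart mu : L2Vec Ω → ℝ) :=
  (continuous_const.mul (continuous_norm.pow 2)).add continuous_integral_norm

/-- For the quadratic part this is the parallelogram law, with equality; the `L¹` part contributes
only the triangle inequality. -/
theorem gradPart_midpoint {Ω : Set Plane} [IsFiniteMeasure (volume.restrict Ω)] (mu : ℝ)
    (G H : L2Vec Ω) :
    2 * gradPart mu ((1 / 2 : ℝ) • (G + H)) + mu / 4 * ‖G - H‖ ^ 2 ≤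
      gradPart mu G + gradPart mu H := by
  have hp := parallelogram_law_with_norm ℝ G H
  have hN : 2 * ∫ x in Ω, ‖((1 / 2 : ℝ) • (G + H) : L2Vec Ω) x‖ ≤
      (∫ x in Ω, ‖G x‖) + ∫ x in Ω, ‖H x‖ := by
    rw [← integral_add (integrable_norm_L2Vec G) (integrable_norm_L2Vec H), ← integral_const_mul]
    refine integral_mono_ae ((integrable_norm_L2Vec _).const_mul 2)
      ((integrable_norm_L2Vec G).add (integrable_norm_L2Vec H)) ?_
    filter_upwards [Lp.coeFn_smul (1 / 2 : ℝ) (G + H), Lp.coeFn_add G H] with x h1 h2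
    rw [h1, Pi.smul_apply, h2, norm_smul, Pi.add_apply]
    have := norm_add_le (G x) (H x)
    norm_num
    linarith
  have hn : ‖((1 / 2 : ℝ) • (G + H) : L2Vec Ω)‖ ^ 2 = ‖G + H‖ ^ 2 / 4 := by
    rw [norm_smul, mul_pow]
    norm_num
    ring
  unfold gradPart
  rw [hn]
  have hp' : mu / 4 * (‖G + H‖ ^ 2 + ‖G - H‖ ^ 2) = mu / 4 * (2 * (‖G‖ ^ 2 + ‖H‖ ^ 2)) := by
    rw [hp]
  linarith

/-! ### Existence and rigidity of minimizers in `[0,∞]` -/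

/-- The properties of a nonnegative fidelity integrand that give existence of minimizers. -/
structure Admissible (Ω₀ : Set Plane) (f : Plane → ℝ) (ψ : ℝ → ℝ → ℝ≥0∞) : Prop where
  measurable : Measurable (Function.uncurry ψ)
  lsc : ∀ᵐ x ∂volume.restrict Ω₀, LowerSemicontinuous (ψ (f x))
  midpoint : ∀ᵐ x ∂volume.restrict Ω₀, ∀ t t' : ℝ,
    2 * ψ (f x) ((1 / 2) * (t + t')) ≤ ψ (f x) t + ψ (f x) t'
  coercive : ∀ᵐ x ∂volume.restrict Ω₀, ∀ t : ℝ,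
    ‖t‖ₑ ≤ 2 * ψ (f x) t + ENNReal.ofReal (2 * (1 + f x ^ 2))

/-- The energy, up to an additive constant, as a functional with values in `[0, ∞]`. -/
noncomputable def total {Ω : Set Plane} (Ω₀ : Set Plane) (A : L2 Ω →L[ℝ] L2 Ω) (lam mu : ℝ)
    (ψ : ℝ → ℝ → ℝ≥0∞) (f g : L2 Ω) : ℝ≥0∞ :=
  ENNReal.ofReal (lam / 2) * fid Ω₀ A ψ f g + ENNReal.ofReal (gradPart mu (weakGrad Ω g))

section

variable {Ω Ω₀ : Set Plane} {A : L2 Ω →L[ℝ] L2 Ω} {lam mu : ℝ} {ψ : ℝ → ℝ → ℝ≥0∞} {f : L2 Ω}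

theorem coeFn_midpoint (hsub : Ω₀ ⊆ Ω) (A : L2 Ω →L[ℝ] L2 Ω) (g h : L2 Ω) :
    ∀ᵐ x ∂volume.restrict Ω₀, A ((1 / 2 : ℝ) • (g + h)) x = (1 / 2) * (A g x + A h x) := by
  have h1 := Lp.coeFn_smul (1 / 2 : ℝ) (A g + A h)
  have h2 := Lp.coeFn_add (A g) (A h)
  filter_upwards [ae_restrict_of_ae_restrict_of_subset hsub h1,
    ae_restrict_of_ae_restrict_of_subset hsub h2] with x h1 h2
  rw [map_smul, map_add, h1, Pi.smul_apply, h2, Pi.add_apply, smul_eq_mul]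

theorem fid_midpoint (hψ : Admissible Ω₀ f ψ) (hsub : Ω₀ ⊆ Ω) (g h : L2 Ω) :
    2 * fid Ω₀ A ψ f ((1 / 2 : ℝ) • (g + h)) ≤ fid Ω₀ A ψ f g + fid Ω₀ A ψ f h := by
  unfold fid
  rw [← lintegral_const_mul _ (measurable_fid_integrand hψ.measurable _ _),
    ← lintegral_add_left (measurable_fid_integrand hψ.measurable _ _)]
  refine lintegral_mono_ae ?_
  filter_upwards [coeFn_midpoint hsub A g h, hψ.midpoint] with x hx hm
  rw [hx]
  exact hm _ _

theorem weakGrad_midpoint (hΩ : IsOpen Ω) {g h : L2 Ω} (hg : g ∈ W12 Ω) (hh : h ∈ W12 Ω) :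
    (1 / 2 : ℝ) • (g + h) ∈ W12 Ω ∧
      weakGrad Ω ((1 / 2 : ℝ) • (g + h)) = (1 / 2 : ℝ) • (weakGrad Ω g + weakGrad Ω h) := by
  have := ((isWeakGradient_weakGrad hg).add (isWeakGradient_weakGrad hh)).smul (1 / 2)
  exact ⟨⟨_, this⟩, this.weakGrad_eq hΩ⟩

/-- The quantitative gap in the gradients drives both existence (Cauchy gradients) and uniqueness
(equal gradients). -/
theorem total_midpoint [IsFiniteMeasure (volume.restrict Ω)] (hψ : Admissible Ω₀ f ψ)
    (hΩ : IsOpen Ω) (hsub : Ω₀ ⊆ Ω) (hmu : 0 < mu) {g h : L2 Ω} (hg : g ∈ W12 Ω)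
    (hh : h ∈ W12 Ω) :
    2 * total Ω₀ A lam mu ψ f ((1 / 2 : ℝ) • (g + h))
        + ENNReal.ofReal (mu / 4 * ‖weakGrad Ω g - weakGrad Ω h‖ ^ 2) ≤
      total Ω₀ A lam mu ψ f g + total Ω₀ A lam mu ψ f h := by
  unfold total
  rw [(weakGrad_midpoint hΩ hg hh).2]
  set G := weakGrad Ω g
  set H := weakGrad Ω h
  have h1 : 2 * ENNReal.ofReal (gradPart mu ((1 / 2 : ℝ) • (G + H)))
      + ENNReal.ofReal (mu / 4 * ‖G - H‖ ^ 2) ≤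
      ENNReal.ofReal (gradPart mu G) + ENNReal.ofReal (gradPart mu H) := by
    have h0 := gradPart_nonneg hmu ((1 / 2 : ℝ) • (G + H))
    rw [two_mul_ofReal, ← ENNReal.ofReal_add (by linarith) (by positivity), ← ENNReal.ofReal_add (gradPart_nonneg hmu G)
      (gradPart_nonneg hmu H)]
    exact ENNReal.ofReal_le_ofReal (gradPart_midpoint mu G H)
  have h2 := mul_le_mul_right (fid_midpoint (A := A) hψ hsub g h) (ENNReal.ofReal (lam / 2))
  calc _ = ENNReal.ofReal (lam / 2) * (2 * fid Ω₀ A ψ f ((1 / 2 : ℝ) • (g + h)))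
        + (2 * ENNReal.ofReal (gradPart mu ((1 / 2 : ℝ) • (G + H)))
          + ENNReal.ofReal (mu / 4 * ‖G - H‖ ^ 2)) := by ring
    _ ≤ _ := add_le_add h2 h1
    _ = _ := by ring

theorem lintegral_enorm_le_of_fid_le (hψ : Admissible Ω₀ f ψ) (u : L2 Ω) :
    ∫⁻ x in Ω₀, ‖A u x‖ₑ ≤
      2 * fid Ω₀ A ψ f u + ∫⁻ x in Ω₀, ENNReal.ofReal (2 * (1 + f x ^ 2)) := by
  unfold fid
  rw [← lintegral_const_mul _ (measurable_fid_integrand hψ.measurable _ _),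
    ← lintegral_add_left ((measurable_fid_integrand hψ.measurable _ _).const_mul 2)]
  refine lintegral_mono_ae ?_
  filter_upwards [hψ.coercive] with x hx using hx _

theorem lintegral_ofReal_ne_top [IsFiniteMeasure (volume.restrict Ω)] (hsub : Ω₀ ⊆ Ω) (f : L2 Ω) :
    ∫⁻ x in Ω₀, ENNReal.ofReal (2 * (1 + f x ^ 2)) ≠ ⊤ := by
  have hI : Integrable (fun x => 2 * (1 + f x ^ 2)) (volume.restrict Ω) :=
    ((integrable_const 1).add (Lp.memLp f).integrable_sq).const_mul 2
  exact ne_top_of_le_ne_top hI.lintegral_lt_top.ne (lintegral_mono_set hsub)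

theorem exists_minimizer_total (hb : Bornology.IsBounded Ω) (hΩ : IsOpen Ω)
    (hL : HasLipschitzBoundary Ω) (hΩ₀ : IsOpen Ω₀) (hsub : Ω₀ ⊆ Ω)
    (hker : kerMasked Ω Ω₀ A ∩ kerGrad Ω = {0}) (hlam : 0 < lam) (hmu : 0 < mu)
    (hψ : Admissible Ω₀ f ψ) (hfin : ∃ h ∈ W12 Ω, total Ω₀ A lam mu ψ f h < ⊤) :
    ∃ g ∈ W12 Ω, ∀ h ∈ W12 Ω, total Ω₀ A lam mu ψ f g ≤ total Ω₀ A lam mu ψ f h := by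
  have := isFiniteMeasure_restrict_of_isBounded hb
  set F := total Ω₀ A lam mu ψ f with hF
  set m : ℝ≥0∞ := ⨅ g ∈ W12 Ω, F g with hm
  have hmle : ∀ h ∈ W12 Ω, m ≤ F h := fun h hh => iInf₂_le h hh
  have hmtop : m ≠ ⊤ := by
    obtain ⟨h, hh, hlt⟩ := hfin
    exact ((hmle h hh).trans_lt hlt).ne
  have hex : ∀ n : ℕ, ∃ g ∈ W12 Ω, F g < m + ((n : ℝ≥0∞) + 1)⁻¹ := by
    intro n
    have : m < m + ((n : ℝ≥0∞) + 1)⁻¹ := ENNReal.lt_add_right hmtop (by simp)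
    obtain ⟨g, hg⟩ := iInf_lt_iff.1 (hm ▸ this)
    obtain ⟨hg1, hg2⟩ := iInf_lt_iff.1 hg
    exact ⟨g, hg1, hg2⟩
  choose u hu hlt using hex
  have hlim : Filter.Tendsto (fun n => F (u n)) Filter.atTop (nhds m) := by
    refine tendsto_of_tendsto_of_tendsto_of_le_of_le (tendsto_const_nhds (x := m)) ?_
      (fun n => hmle _ (hu n)) (fun n => (hlt n).le)
    have h0 : Filter.Tendsto (fun n : ℕ => ((n : ℝ≥0∞) + 1)⁻¹) Filter.atTop (nhds 0) := by
      have := ENNReal.tendsto_inv_nat_nhds_zero.comp (Filter.tendsto_add_atTop_nat 1)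
      simpa [Function.comp_def] using this
    simpa using h0.const_add m
  have hbound : ∀ n, F (u n) ≤ m + 1 := fun n => (hlt n).le.trans (by
    gcongr
    rw [ENNReal.inv_le_one]
    exact le_add_self)
  set G : ℕ → L2Vec Ω := fun n => weakGrad Ω (u n) with hG
  have hwG : ∀ n, IsWeakGradient Ω (u n) (G n) := fun n => isWeakGradient_weakGrad (hu n)
  -- Midpoints are competitors, so the gap is at most `F (u p) + F (u q) - 2 * m`, which tends to
  -- `0`.
  have hcau : CauchySeq G := by
    rw [cauchySeq_iff_tendsto_dist_atTop_0]
    have h1 : Filter.Tendsto (fun p : ℕ × ℕ => F (u p.1) + F (u p.2) - 2 * m)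
        Filter.atTop (nhds (m + m - 2 * m)) := by
      rw [← Filter.prod_atTop_atTop_eq]
      exact ENNReal.Tendsto.sub ((hlim.comp Filter.tendsto_fst).add
        (hlim.comp Filter.tendsto_snd)) tendsto_const_nhds
        (Or.inr (ENNReal.mul_ne_top (by simp) hmtop))
    rw [two_mul, tsub_self] at h1
    have h2 : Filter.Tendsto (fun p : ℕ × ℕ => ENNReal.ofReal (mu / 4 * ‖G p.1 - G p.2‖ ^ 2))
        Filter.atTop (nhds 0) := by
      refine tendsto_of_tendsto_of_tendsto_of_le_of_le tendsto_const_nhds h1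
        (fun _ => zero_le) fun p => ?_
      refine ENNReal.le_sub_of_add_le_left (ENNReal.add_ne_top.2 ⟨hmtop, hmtop⟩) ?_
      rw [← two_mul]
      refine le_trans ?_ (total_midpoint hψ hΩ hsub hmu (hu p.1) (hu p.2))
      gcongr
      exact hmle _ (weakGrad_midpoint hΩ (hu p.1) (hu p.2)).1
    have h3 := (ENNReal.tendsto_toReal ENNReal.zero_ne_top).comp h2
    have h4 : Filter.Tendsto (fun p : ℕ × ℕ => mu / 4 * ‖G p.1 - G p.2‖ ^ 2)
        Filter.atTop (nhds 0) := by
      refine h3.congr fun p => ?_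
      simp only [Function.comp_apply]
      exact ENNReal.toReal_ofReal (by positivity)
    have h5 := (h4.const_mul (4 / mu)).sqrt
    rw [mul_zero, Real.sqrt_zero] at h5
    refine h5.congr fun p => ?_
    rw [dist_eq_norm, ← mul_assoc, div_mul_div_comm, mul_comm 4 mu, div_self (by positivity),
      one_mul, Real.sqrt_sq (norm_nonneg _)]
  obtain ⟨G₀, hG₀⟩ := cauchySeq_tendsto_of_complete hcau
  set c : ℝ≥0∞ := ENNReal.ofReal (lam / 2) with hc
  have hc0 : c ≠ 0 := (ENNReal.ofReal_pos.2 (by positivity)).ne'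
  have hct : c ≠ ⊤ := ENNReal.ofReal_ne_top
  have hfid : ∀ n, fid Ω₀ A ψ f (u n) ≤ c⁻¹ * (m + 1) := by
    intro n
    rw [mul_comm, ← div_eq_mul_inv, ENNReal.le_div_iff_mul_le (Or.inl hc0) (Or.inl hct), mul_comm]
    exact le_self_add.trans (hbound n)
  obtain ⟨R, hR⟩ := hcau.isBounded_range.exists_norm_le
  obtain ⟨C, hC⟩ := exists_norm_le hb hΩ hL hΩ₀ hsub A hker
  set P : ℝ≥0∞ := 2 * (c⁻¹ * (m + 1)) + ∫⁻ x in Ω₀, ENNReal.ofReal (2 * (1 + f x ^ 2)) with hPdef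
  have hP : P ≠ ⊤ := by
    refine ENNReal.add_ne_top.2 ⟨ENNReal.mul_ne_top (by simp) (ENNReal.mul_ne_top
      (ENNReal.inv_ne_top.2 hc0) (ENNReal.add_ne_top.2 ⟨hmtop, by simp⟩)),
      lintegral_ofReal_ne_top hsub f⟩
  have hun : ∀ n, ‖u n‖ ≤ |C| * (P.toReal + R) := by
    intro n
    have hRn : ‖G n‖ ≤ R := hR _ ⟨n, rfl⟩
    refine (hC (u n) (G n) P.toReal (hwG n) ENNReal.toReal_nonneg ?_).trans ?_
    · rw [ENNReal.ofReal_toReal hP]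
      refine (lintegral_enorm_le_of_fid_le hψ (u n)).trans ?_
      rw [hPdef]
      gcongr
      exact hfid n
    · have : 0 ≤ P.toReal := ENNReal.toReal_nonneg
      gcongr
      exact le_abs_self C
  obtain ⟨φ, u₀, hφ, hu₀⟩ := exists_subseq_tendsto hb hΩ hL hwG hun hcau
  have hw₀ : IsWeakGradient Ω u₀ G₀ :=
    isWeakGradient_of_tendsto (fun n => hwG (φ n)) hu₀ (hG₀.comp hφ.tendsto_atTop)
  obtain ⟨ns, hns, hliminf⟩ := exists_subseq_fid_le_liminf hsub A hψ.measurable hψ.lsc hu₀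
  have hτ : Filter.Tendsto (fun k => φ (ns k)) Filter.atTop Filter.atTop :=
    hφ.tendsto_atTop.comp hns.tendsto_atTop
  set r : L2Vec Ω → ℝ≥0∞ := fun G => ENNReal.ofReal (gradPart mu G) with hr
  have hrlim : Filter.Tendsto (fun n => r (G n)) Filter.atTop (nhds (r G₀)) :=
    ENNReal.tendsto_ofReal (((continuous_gradPart mu).tendsto G₀).comp hG₀)
  -- Since `r (G n)` is finite and converges, the fidelities themselves converge; hence the lower
  -- limit along the subsequence taken for Fatou is explicit.
  have hFsub : ∀ n, fid Ω₀ A ψ f (u n) = c⁻¹ * (F (u n) - r (G n)) := by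
    intro n
    have : F (u n) - r (G n) = c * fid Ω₀ A ψ f (u n) :=
      ENNReal.add_sub_cancel_right ENNReal.ofReal_ne_top
    rw [this, ← mul_assoc, ENNReal.inv_mul_cancel hc0 hct, one_mul]
  have hfidlim : Filter.Tendsto (fun n => fid Ω₀ A ψ f (u n)) Filter.atTop
      (nhds (c⁻¹ * (m - r G₀))) := by
    simp only [hFsub]
    exact ENNReal.Tendsto.const_mul (ENNReal.Tendsto.sub hlim hrlim (Or.inl hmtop))
      (Or.inr (ENNReal.inv_ne_top.2 hc0))
  rw [show Filter.liminf (fun k => fid Ω₀ A ψ f ((u ∘ φ) (ns k))) Filter.atTop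
    = c⁻¹ * (m - r G₀) from (hfidlim.comp hτ).liminf_eq] at hliminf
  have hrm : r G₀ ≤ m := le_of_tendsto_of_tendsto' hrlim hlim fun n => le_add_self
  refine ⟨u₀, ⟨G₀, hw₀⟩, fun h hh => le_trans ?_ (hmle h hh)⟩
  have hF₀ : F u₀ = c * fid Ω₀ A ψ f u₀ + r G₀ := by
    rw [hF, total, hw₀.weakGrad_eq hΩ]
  rw [hF₀]
  calc c * fid Ω₀ A ψ f u₀ + r G₀ ≤ c * (c⁻¹ * (m - r G₀)) + r G₀ := by gcongr
    _ = m := by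
      rw [← mul_assoc, ENNReal.mul_inv_cancel hc0 hct, one_mul, tsub_add_cancel_of_le hrm]

/-- Two minimizers have the same gradient and the same fidelity, and the fidelity integrand is
affine between them. -/
theorem minimizer_total_pair (hb : Bornology.IsBounded Ω) (hΩ : IsOpen Ω)
    (hsub : Ω₀ ⊆ Ω) (hlam : 0 < lam) (hmu : 0 < mu)
    (hψ : Admissible Ω₀ f ψ) (hfin : ∃ h ∈ W12 Ω, total Ω₀ A lam mu ψ f h < ⊤)
    {g g' : L2 Ω} (hg : g ∈ W12 Ω) (hg' : g' ∈ W12 Ω)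
    (hgm : ∀ h ∈ W12 Ω, total Ω₀ A lam mu ψ f g ≤ total Ω₀ A lam mu ψ f h)
    (hgm' : ∀ h ∈ W12 Ω, total Ω₀ A lam mu ψ f g' ≤ total Ω₀ A lam mu ψ f h) :
    g - g' ∈ kerGrad Ω ∧ fid Ω₀ A ψ f g ≠ ⊤ ∧ fid Ω₀ A ψ f g = fid Ω₀ A ψ f g' ∧
      ∀ᵐ x ∂volume.restrict Ω₀, ψ (f x) (A g x) ≠ ⊤ ∧ ψ (f x) (A g' x) ≠ ⊤ ∧
        2 * ψ (f x) ((1 / 2) * (A g x + A g' x)) = ψ (f x) (A g x) + ψ (f x) (A g' x) := by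
  have := isFiniteMeasure_restrict_of_isBounded hb
  set c : ℝ≥0∞ := ENNReal.ofReal (lam / 2) with hc
  have hc0 : c ≠ 0 := (ENNReal.ofReal_pos.2 (by positivity)).ne'
  have hct : c ≠ ⊤ := ENNReal.ofReal_ne_top
  set F := total Ω₀ A lam mu ψ f with hF
  have hFeq : F g = F g' := le_antisymm (hgm _ hg') (hgm' _ hg)
  have hFtop : F g ≠ ⊤ := by
    obtain ⟨h, hh, hlt⟩ := hfin
    exact ((hgm h hh).trans_lt hlt).ne
  have hmem := weakGrad_midpoint hΩ hg hg'
  have hmid := total_midpoint (A := A) (lam := lam) hψ hΩ hsub hmu hg hg'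
  rw [← hF, ← hFeq, ← two_mul] at hmid
  have hgrad : weakGrad Ω g - weakGrad Ω g' = 0 := by
    have h1 : 2 * F g + ENNReal.ofReal (mu / 4 * ‖weakGrad Ω g - weakGrad Ω g'‖ ^ 2) ≤
        2 * F g + 0 := by
      rw [add_zero]
      refine le_trans ?_ hmid
      gcongr
      exact hgm _ hmem.1
    have h2 := (ENNReal.add_le_add_iff_left (ENNReal.mul_ne_top (by simp) hFtop)).1 h1
    rw [nonpos_iff_eq_zero, ENNReal.ofReal_eq_zero] at h2
    have h3 : ‖weakGrad Ω g - weakGrad Ω g'‖ ^ 2 ≤ 0 := by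
      have : 0 < mu / 4 := by positivity
      by_contra! h
      exact absurd h2 (not_le.2 (mul_pos this h))
    exact norm_eq_zero.1 (pow_eq_zero_iff two_ne_zero |>.1 (le_antisymm h3 (sq_nonneg _)))
  have hker : g - g' ∈ kerGrad Ω := by
    have := (isWeakGradient_weakGrad hg).sub (isWeakGradient_weakGrad hg')
    rwa [hgrad] at this
  have hgg : weakGrad Ω g' = weakGrad Ω g := (sub_eq_zero.1 hgrad).symm
  set r : ℝ≥0∞ := ENNReal.ofReal (gradPart mu (weakGrad Ω g)) with hr
  have hrt : r ≠ ⊤ := ENNReal.ofReal_ne_top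
  have e1 : F g = c * fid Ω₀ A ψ f g + r := rfl
  have e2 : F g' = c * fid Ω₀ A ψ f g' + r := by rw [hF, total, hgg]
  have e3 : F ((1 / 2 : ℝ) • (g + g')) = c * fid Ω₀ A ψ f ((1 / 2 : ℝ) • (g + g')) + r := by
    rw [hF, total, hmem.2, hgg, ← two_smul ℝ (weakGrad Ω g), smul_smul]
    norm_num
    rfl
  have hfid : fid Ω₀ A ψ f g = fid Ω₀ A ψ f g' := by
    rw [e1, e2, ENNReal.add_left_inj hrt, ENNReal.mul_right_inj hc0 hct] at hFeq
    exact hFeq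
  have hfidt : fid Ω₀ A ψ f g ≠ ⊤ := by
    intro h
    apply hFtop
    rw [e1, h, ENNReal.mul_top hc0, top_add]
  have hfidm : fid Ω₀ A ψ f g ≤ fid Ω₀ A ψ f ((1 / 2 : ℝ) • (g + g')) := by
    have h := hgm _ hmem.1
    rw [e1, e3, ENNReal.add_le_add_iff_right hrt, ENNReal.mul_le_mul_iff_right hc0 hct] at h
    exact h
  have hmeas := fun u => measurable_fid_integrand hψ.measurable f (A u)
  -- Midpoint convexity gives one inequality pointwise, minimality the reverse one for the finite
  -- integrals, so equality holds almost everywhere.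
  have hae : (fun x => 2 * ψ (f x) (A ((1 / 2 : ℝ) • (g + g')) x)) =ᵐ[volume.restrict Ω₀]
      fun x => ψ (f x) (A g x) + ψ (f x) (A g' x) := by
    refine ae_eq_of_ae_le_of_lintegral_le ?_ ?_ ((hmeas g).add (hmeas g')).aemeasurable ?_
    · filter_upwards [coeFn_midpoint hsub A g g', hψ.midpoint] with x hx hm
      rw [hx]
      exact hm _ _
    · rw [lintegral_const_mul _ (hmeas _)]
      have := fid_midpoint (A := A) hψ hsub g g'
      refine ne_top_of_le_ne_top ?_ this
      rw [← hfid]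
      exact ENNReal.add_ne_top.2 ⟨hfidt, hfidt⟩
    · rw [lintegral_const_mul _ (hmeas _), lintegral_add_left (hmeas _)]
      change fid Ω₀ A ψ f g + fid Ω₀ A ψ f g' ≤ 2 * fid Ω₀ A ψ f _
      rw [← hfid, ← two_mul]
      gcongr
  refine ⟨hker, hfidt, hfid, ?_⟩
  filter_upwards [hae, coeFn_midpoint hsub A g g', ae_lt_top (hmeas g) hfidt,
    ae_lt_top (hmeas g') (show fid Ω₀ A ψ f g' ≠ ⊤ from hfid ▸ hfidt)] with x h1 h2 h3 h4
  rw [h2] at h1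
  exact ⟨h3.ne, h4.ne, h1⟩

end

/-! ### From the extended real energy to `[0,∞]` -/

theorem toENNReal_sub_add (p : ℝ≥0∞) {q : ℝ} (hq : 0 ≤ q) :
    ((p : EReal) - (q : EReal)).toENNReal + ENNReal.ofReal q =
      p + (-((p : EReal) - (q : EReal))).toENNReal := by
  induction p with
  | top => simp
  | coe p =>
    have h1 : (((p : ℝ≥0∞) : EReal) - (q : EReal)) = ((p - q : ℝ) : EReal) := rfl
    rw [h1, ← EReal.coe_neg, EReal.real_coe_toENNReal, EReal.real_coe_toENNReal,
      ← ENNReal.ofReal_coe_nnreal]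
    have hp : (0 : ℝ) ≤ p := p.2
    rcases le_total (p : ℝ) q with h | h
    · rw [ENNReal.ofReal_of_nonpos (sub_nonpos.2 h), zero_add,
        ← ENNReal.ofReal_add hp (by linarith)]
      congr 1; ring
    · rw [ENNReal.ofReal_of_nonpos (show -((p : ℝ) - q) ≤ 0 by linarith), add_zero,
        ← ENNReal.ofReal_add (by linarith) hq]
      congr 1; ring

/-- The negative part is dominated by the integrable `q`, so no `∞ - ∞` arises even if `p` has
infinite integral. The comparison is made through sums, as subtraction in `[0,∞]` truncates. -/
theorem eintegral_eq_sub {μ : Measure Plane} {h : Plane → EReal} {p : Plane → ℝ≥0∞}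
    {q : Plane → ℝ} (hp : Measurable p) (hqi : Integrable q μ) (hq : ∀ x, 0 ≤ q x)
    (hh : ∀ᵐ x ∂μ, h x = (p x : EReal) - (q x : EReal)) :
    eintegral μ h = ((∫⁻ x, p x ∂μ : ℝ≥0∞) : EReal) - ((∫ x, q x ∂μ : ℝ) : EReal) := by
  have hqm : AEMeasurable (fun x => ENNReal.ofReal (q x)) μ :=
    hqi.aestronglyMeasurable.aemeasurable.ennreal_ofReal
  have hsum : (∫⁻ x, (h x).toENNReal ∂μ) + ENNReal.ofReal (∫ x, q x ∂μ) =
      (∫⁻ x, p x ∂μ) + ∫⁻ x, (-h x).toENNReal ∂μ := by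
    rw [ofReal_integral_eq_lintegral_ofReal hqi (Filter.Eventually.of_forall hq),
      ← lintegral_add_right' _ hqm, ← lintegral_add_left hp]
    refine lintegral_congr_ae ?_
    filter_upwards [hh] with x hx
    rw [hx, toENNReal_sub_add _ (hq x)]
  have hneg : ∫⁻ x, (-h x).toENNReal ∂μ ≠ ⊤ := by
    refine ne_top_of_le_ne_top hqi.lintegral_lt_top.ne (lintegral_mono_ae ?_)
    filter_upwards [hh] with x hx
    rw [hx, ← EReal.real_coe_toENNReal]
    refine EReal.toENNReal_le_toENNReal ?_
    rw [EReal.neg_sub (Or.inr (EReal.coe_ne_bot _)) (Or.inr (EReal.coe_ne_top _)), add_comm,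
      ← sub_eq_add_neg]
    exact (EReal.sub_le_sub le_rfl (EReal.coe_ennreal_nonneg _)).trans (by simp)
  unfold eintegral
  have hQ : 0 ≤ ∫ x, q x ∂μ := integral_nonneg hq
  generalize (∫⁻ x, (h x).toENNReal ∂μ) = a at *
  generalize (∫⁻ x, (-h x).toENNReal ∂μ) = b at *
  generalize (∫⁻ x, p x ∂μ) = P at *
  generalize (∫ x, q x ∂μ) = Q at *
  lift b to ℝ≥0 using hneg
  induction P with
  | top =>
    have : a = ⊤ := by
      by_contra ha
      simp [ha] at hsum
    subst this
    change (⊤ : EReal) - ((b : ℝ) : EReal) = ⊤ - (Q : EReal)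
    rw [EReal.top_sub_coe, EReal.top_sub_coe]
  | coe P =>
    have ha : a ≠ ⊤ := by
      rintro rfl
      rw [top_add] at hsum
      exact ENNReal.add_ne_top.2 ⟨ENNReal.coe_ne_top, ENNReal.coe_ne_top⟩ hsum.symm
    lift a to ℝ≥0 using ha
    have hr := congrArg ENNReal.toReal hsum
    rw [ENNReal.toReal_add (by simp) (by simp), ENNReal.toReal_add (by simp) (by simp),
      ENNReal.toReal_ofReal hQ] at hr
    simp only [ENNReal.coe_toReal] at hr
    change (((a : ℝ) - (b : ℝ) : ℝ) : EReal) = (((P : ℝ) - Q : ℝ) : EReal)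
    congr 1
    linarith

theorem eintegral_indicator {Ω Ω₀ : Set Plane} (hΩ₀ : MeasurableSet Ω₀) (hsub : Ω₀ ⊆ Ω)
    (h : Plane → EReal) :
    eintegral (volume.restrict Ω) (Ω₀.indicator h) = eintegral (volume.restrict Ω₀) h := by
  have h1 : ∀ k : EReal → ℝ≥0∞, k 0 = 0 →
      ∫⁻ x in Ω, k (Ω₀.indicator h x) = ∫⁻ x in Ω₀, k (h x) := by
    intro k hk
    have : (fun x => k (Ω₀.indicator h x)) = Ω₀.indicator fun x => k (h x) := by
      ext x
      by_cases hx : x ∈ Ω₀ <;> simp [hx, hk]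
    rw [this, lintegral_indicator hΩ₀, Measure.restrict_restrict hΩ₀, Set.inter_eq_left.2 hsub]
  unfold eintegral
  rw [h1 EReal.toENNReal (by simp), h1 (fun y => (-y).toENNReal) (by simp)]

section

variable {Ω Ω₀ : Set Plane} {A : L2 Ω →L[ℝ] L2 Ω} {lam mu : ℝ} {ψ : ℝ → ℝ → ℝ≥0∞} {f : L2 Ω}
  {φ : ℝ → ℝ → EReal}

/-- The subtracted constant is finite and independent of `g`, so minimizers and finiteness can be
studied for `total`. -/
theorem energy_eq [IsFiniteMeasure (volume.restrict Ω)] (hΩ₀ : MeasurableSet Ω₀) (hsub : Ω₀ ⊆ Ω)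
    (hlam : 0 < lam) (hmu : 0 < mu) (hψ : Measurable (Function.uncurry ψ))
    (hφ : ∀ᵐ x ∂volume.restrict Ω₀, ∀ t, φ (f x) t = (ψ (f x) t : EReal) - ((f x ^ 2 : ℝ) : EReal))
    (g : L2 Ω) :
    energy Ω Ω₀ A lam mu φ f g = (total Ω₀ A lam mu ψ f g : EReal)
      - ((lam / 2 * ∫ x in Ω₀, f x ^ 2 : ℝ) : EReal) := by
  have hfi : Integrable (fun x => f x ^ 2) (volume.restrict Ω₀) :=
    ((Lp.memLp f).mono_measure (Measure.restrict_mono hsub le_rfl)).integrable_sq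
  have hint := eintegral_eq_sub (h := fun x => φ (f x) (A g x))
    (measurable_fid_integrand hψ f (A g)) hfi (fun x => sq_nonneg _) (by
      filter_upwards [hφ] with x hx using hx _)
  have hgp := gradPart_nonneg hmu (weakGrad Ω g)
  unfold energy
  rw [eintegral_indicator hΩ₀ hsub, hint, integral_norm_sq_eq, add_assoc, ← EReal.coe_add]
  change _ * (((fid Ω₀ A ψ f g : ℝ≥0∞) : EReal) - _) + ((gradPart mu (weakGrad Ω g) : ℝ) : EReal) = _
  unfold total
  have hl2 : 0 < lam / 2 := by positivity
  generalize gradPart mu (weakGrad Ω g) = r at *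
  generalize (∫ x in Ω₀, f x ^ 2) = D
  generalize fid Ω₀ A ψ f g = K
  induction K with
  | top =>
    rw [ENNReal.mul_top (ENNReal.ofReal_pos.2 hl2).ne', top_add, EReal.coe_ennreal_top,
      EReal.top_sub_coe, EReal.top_sub_coe, EReal.coe_mul_top_of_pos hl2, EReal.top_add_coe]
  | coe K =>
    rw [← ENNReal.ofReal_coe_nnreal, ← ENNReal.ofReal_mul hl2.le,
      ← ENNReal.ofReal_add (by positivity) hgp, EReal.coe_ennreal_ofReal, EReal.coe_ennreal_ofReal,
      max_eq_left (by positivity), max_eq_left (by positivity), ← EReal.coe_sub, ← EReal.coe_sub,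
      ← EReal.coe_mul, ← EReal.coe_add]
    congr 1
    ring

theorem coe_sub_coe_le_iff (a b : ℝ≥0∞) (c : ℝ) :
    (a : EReal) - (c : EReal) ≤ (b : EReal) - (c : EReal) ↔ a ≤ b := by
  constructor
  · intro h
    have := add_le_add_left h (c : EReal)
    rw [EReal.sub_add_cancel, EReal.sub_add_cancel] at this
    exact EReal.coe_ennreal_le_coe_ennreal_iff.1 this
  · exact fun h => EReal.sub_le_sub (EReal.coe_ennreal_le_coe_ennreal_iff.2 h) le_rfl

theorem isMinimizer_energy_iff [IsFiniteMeasure (volume.restrict Ω)] (hΩ₀ : MeasurableSet Ω₀)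
    (hsub : Ω₀ ⊆ Ω) (hlam : 0 < lam) (hmu : 0 < mu) (hψ : Measurable (Function.uncurry ψ))
    (hφ : ∀ᵐ x ∂volume.restrict Ω₀, ∀ t, φ (f x) t = (ψ (f x) t : EReal) - ((f x ^ 2 : ℝ) : EReal))
    (g : L2 Ω) :
    IsMinimizer Ω (energy Ω Ω₀ A lam mu φ f) g ↔
      g ∈ W12 Ω ∧ ∀ h ∈ W12 Ω, total Ω₀ A lam mu ψ f g ≤ total Ω₀ A lam mu ψ f h := by
  unfold IsMinimizer
  simp only [energy_eq hΩ₀ hsub hlam hmu hψ hφ, coe_sub_coe_le_iff]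

theorem total_lt_top_of_energy_lt_top [IsFiniteMeasure (volume.restrict Ω)]
    (hΩ₀ : MeasurableSet Ω₀) (hsub : Ω₀ ⊆ Ω) (hlam : 0 < lam) (hmu : 0 < mu)
    (hψ : Measurable (Function.uncurry ψ))
    (hφ : ∀ᵐ x ∂volume.restrict Ω₀, ∀ t, φ (f x) t = (ψ (f x) t : EReal) - ((f x ^ 2 : ℝ) : EReal))
    {g : L2 Ω} (h : energy Ω Ω₀ A lam mu φ f g < ⊤) : total Ω₀ A lam mu ψ f g < ⊤ := by
  rw [energy_eq hΩ₀ hsub hlam hmu hψ hφ] at h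
  refine lt_top_iff_ne_top.2 fun htop => ?_
  rw [htop, EReal.coe_ennreal_top, EReal.top_sub_coe] at h
  exact lt_irrefl _ h

end

/-! ### Gaussian fidelity -/

/-- The Gaussian fidelity, shifted by the square of the datum. -/
noncomputable def gaussInt (s t : ℝ) : ℝ≥0∞ := ENNReal.ofReal ((s - t) ^ 2 + s ^ 2)

/-- The sign does not call for a shift here; it gives the Gaussian case the same form as the Poisson
case. -/
theorem gaussFid_eq (s t : ℝ) :
    gaussFid s t = (gaussInt s t : EReal) - ((s ^ 2 : ℝ) : EReal) := by
  rw [gaussInt, gaussFid, EReal.coe_ennreal_ofReal, max_eq_left (by positivity), ← EReal.coe_sub,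
    add_sub_cancel_right]

theorem admissible_gaussInt (Ω₀ : Set Plane) (f : Plane → ℝ) : Admissible Ω₀ f gaussInt where
  measurable := by
    unfold gaussInt Function.uncurry
    fun_prop
  lsc := Filter.Eventually.of_forall fun x => by
    refine Continuous.lowerSemicontinuous ?_
    unfold gaussInt
    exact ENNReal.continuous_ofReal.comp (by fun_prop)
  midpoint := Filter.Eventually.of_forall fun x t t' => by
    unfold gaussInt
    rw [two_mul_ofReal, ← ENNReal.ofReal_add (by positivity) (by positivity)]
    apply ENNReal.ofReal_le_ofReal
    nlinarith [sq_nonneg (t - t')]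
  coercive := Filter.Eventually.of_forall fun x t => by
    unfold gaussInt
    rw [two_mul_ofReal, ← ENNReal.ofReal_add (by positivity) (by positivity),
      Real.enorm_eq_ofReal_abs]
    apply ENNReal.ofReal_le_ofReal
    rw [abs_le]
    constructor <;> nlinarith [sq_nonneg (f x - t), sq_nonneg (t - 1), sq_nonneg (t + 1),
      sq_nonneg (2 * f x - t), sq_nonneg (f x)]

/-- The midpoint deficit is exactly `(t - t') ^ 2 / 2`. -/
theorem gaussInt_strict {s t t' : ℝ}
    (h : 2 * gaussInt s ((1 / 2) * (t + t')) = gaussInt s t + gaussInt s t') : t = t' := by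
  unfold gaussInt at h
  rw [two_mul_ofReal, ← ENNReal.ofReal_add (by positivity) (by positivity),
    ENNReal.ofReal_eq_ofReal_iff (by positivity) (by positivity)] at h
  have : (t - t') ^ 2 = 0 := by nlinarith
  exact sub_eq_zero.1 (pow_eq_zero_iff two_ne_zero |>.1 this)

/-! ### Poisson fidelity -/

/-- The Poisson fidelity, shifted by the square of the datum. -/
noncomputable def poissonInt (s t : ℝ) : ℝ≥0∞ :=
  if 0 < t then ENNReal.ofReal (t - s * Real.log t + s ^ 2)
  else if t = 0 ∧ s = 0 then 0
  else ⊤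

theorem poissonInt_of_pos (s : ℝ) {t : ℝ} (ht : 0 < t) :
    poissonInt s t = ENNReal.ofReal (t - s * Real.log t + s ^ 2) := if_pos ht

theorem poissonInt_of_neg (s : ℝ) {t : ℝ} (ht : t < 0) : poissonInt s t = ⊤ := by
  rw [poissonInt, if_neg ht.not_gt, if_neg fun h => ht.ne h.1]

theorem poissonInt_zero_right {s : ℝ} (hs : 0 < s) : poissonInt s 0 = ⊤ := by
  rw [poissonInt, if_neg (lt_irrefl _), if_neg fun h => hs.ne' h.2]

theorem poissonInt_zero_left {t : ℝ} (ht : 0 ≤ t) : poissonInt 0 t = ENNReal.ofReal t := by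
  rcases ht.eq_or_lt with rfl | ht
  · simp [poissonInt]
  · rw [poissonInt_of_pos _ ht]
    congr 1; ring

theorem pos_of_poissonInt_ne_top {s t : ℝ} (hs : 0 < s) (h : poissonInt s t ≠ ⊤) : 0 < t := by
  rcases lt_trichotomy t 0 with ht | rfl | ht
  · exact absurd (poissonInt_of_neg s ht) h
  · exact absurd (poissonInt_zero_right hs) h
  · exact ht

theorem nonneg_of_poissonInt_ne_top {s t : ℝ} (h : poissonInt s t ≠ ⊤) : 0 ≤ t := by
  by_contra! ht
  exact h (poissonInt_of_neg s ht)

/-- Apply `log x ≤ x - 1` to `t / (c * s)` and to `c * s`. The value `c = 1` yields nonnegativity of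
the shifted integrand, and `c = 2` its coercivity. -/
theorem mul_log_le {s t c : ℝ} (hs : 0 ≤ s) (hc : 0 < c) (ht : 0 < t) :
    c * s * Real.log t ≤ t - 2 * c * s + (c * s) ^ 2 := by
  rcases hs.eq_or_lt with rfl | hs
  · simpa using ht.le
  · have hcs : 0 < c * s := by positivity
    have h1 := Real.log_le_sub_one_of_pos (show 0 < t / (c * s) by positivity)
    have h2 := Real.log_le_sub_one_of_pos hcs
    rw [Real.log_div ht.ne' hcs.ne'] at h1
    have h3 : Real.log t ≤ t / (c * s) - 2 + c * s := by linarith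
    calc c * s * Real.log t ≤ c * s * (t / (c * s) - 2 + c * s) := by gcongr
      _ = t - 2 * c * s + (c * s) ^ 2 := by field_simp

theorem poisson_nonneg {s t : ℝ} (hs : 0 ≤ s) (ht : 0 < t) : 0 ≤ t - s * Real.log t + s ^ 2 := by
  have := mul_log_le hs one_pos ht
  linarith

theorem poissonFid_eq {s : ℝ} (hs : 0 ≤ s) (t : ℝ) :
    poissonFid s t = (poissonInt s t : EReal) - ((s ^ 2 : ℝ) : EReal) := by
  unfold poissonFid poissonInt
  split_ifs with h1 h2
  · rw [EReal.coe_ennreal_ofReal, max_eq_left (poisson_nonneg hs h1), ← EReal.coe_sub,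
      add_sub_cancel_right]
  · simp [h2.2]
  · rw [EReal.coe_ennreal_top, EReal.top_sub_coe]

theorem measurable_poissonInt : Measurable (Function.uncurry poissonInt) := by
  unfold poissonInt Function.uncurry
  refine Measurable.ite (measurableSet_lt measurable_const measurable_snd) (by fun_prop) ?_
  refine Measurable.ite ?_ measurable_const measurable_const
  exact (measurableSet_eq_fun measurable_snd measurable_const).inter
    (measurableSet_eq_fun measurable_fst measurable_const)

theorem lowerSemicontinuous_poissonInt {s : ℝ} (hs : 0 ≤ s) :
    LowerSemicontinuous (poissonInt s) := by
  intro t y hy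
  rcases lt_trichotomy t 0 with ht | rfl | ht
  · filter_upwards [Iio_mem_nhds ht] with t' ht'
    rw [poissonInt_of_neg s ht']
    rwa [poissonInt_of_neg s ht] at hy
  · rcases hs.eq_or_lt with rfl | hs
    · rw [poissonInt_zero_left le_rfl, ENNReal.ofReal_zero] at hy
      exact absurd hy not_lt_zero
    · rw [poissonInt_zero_right hs] at hy
      -- Below this threshold `-s * log t'` already exceeds `y`, so the integrand blows up
      -- continuously towards its value `∞` at `0`.
      filter_upwards [Iio_mem_nhds (Real.exp_pos (-y.toReal / s))] with t' ht'
      by_cases h : 0 < t'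
      · rw [poissonInt_of_pos s h, ← ENNReal.ofReal_toReal hy.ne]
        have hlog : Real.log t' < -y.toReal / s := (Real.log_lt_iff_lt_exp h).2 ht'
        rw [lt_div_iff₀ hs] at hlog
        have hlt : y.toReal < t' - s * Real.log t' + s ^ 2 := by nlinarith [sq_nonneg s]
        exact (ENNReal.ofReal_lt_ofReal_iff (ENNReal.toReal_nonneg.trans_lt hlt)).2 hlt
      · rcases (not_lt.1 h).eq_or_lt with rfl | h
        · rwa [poissonInt_zero_right hs]
        · rwa [poissonInt_of_neg s h]
  · have hc : ContinuousAt (fun t => ENNReal.ofReal (t - s * Real.log t + s ^ 2)) t :=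
      ENNReal.continuous_ofReal.continuousAt.comp
        ((continuousAt_id.sub (continuousAt_const.mul (Real.continuousAt_log ht.ne'))).add
          continuousAt_const)
    rw [poissonInt_of_pos s ht] at hy
    filter_upwards [Ioi_mem_nhds ht, hc.eventually_const_lt hy] with t' ht' h
    rwa [poissonInt_of_pos s ht']

theorem log_midpoint_lt {t t' : ℝ} (ht : 0 < t) (ht' : 0 < t') (hne : t ≠ t') :
    Real.log t + Real.log t' < 2 * Real.log ((1 / 2) * (t + t')) := by
  have := strictConcaveOn_log_Ioi.2 (Set.mem_Ioi.2 ht) (Set.mem_Ioi.2 ht') hne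
    (show (0 : ℝ) < 1 / 2 by norm_num) (show (0 : ℝ) < 1 / 2 by norm_num) (by norm_num)
  simp only [smul_eq_mul, ← mul_add] at this
  linarith

theorem poissonInt_midpoint {s : ℝ} (hs : 0 ≤ s) (t t' : ℝ) :
    2 * poissonInt s ((1 / 2) * (t + t')) ≤ poissonInt s t + poissonInt s t' := by
  by_cases h : poissonInt s t = ⊤
  · simp [h]
  by_cases h' : poissonInt s t' = ⊤
  · simp [h']
  rcases hs.eq_or_lt with rfl | hs
  · have ht := nonneg_of_poissonInt_ne_top h
    have ht' := nonneg_of_poissonInt_ne_top h'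
    rw [poissonInt_zero_left ht, poissonInt_zero_left ht', poissonInt_zero_left (by positivity),
      two_mul_ofReal, ← ENNReal.ofReal_add ht ht']
    apply le_of_eq
    congr 1; ring
  · have ht := pos_of_poissonInt_ne_top hs h
    have ht' := pos_of_poissonInt_ne_top hs h'
    rw [poissonInt_of_pos s ht, poissonInt_of_pos s ht', poissonInt_of_pos s (by positivity),
      two_mul_ofReal, ← ENNReal.ofReal_add (poisson_nonneg hs.le ht) (poisson_nonneg hs.le ht')]
    apply ENNReal.ofReal_le_ofReal
    have hlog : Real.log t + Real.log t' ≤ 2 * Real.log ((1 / 2) * (t + t')) := by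
      by_cases hne : t = t'
      · subst hne
        rw [show (1 / 2) * (t + t) = t by ring]
        linarith
      · exact (log_midpoint_lt ht ht' hne).le
    nlinarith

/-- Finiteness with `s > 0` makes both arguments positive, where strict concavity of the logarithm
applies. -/
theorem poissonInt_strict {s t t' : ℝ} (hs : 0 < s) (h : poissonInt s t ≠ ⊤)
    (h' : poissonInt s t' ≠ ⊤)
    (heq : 2 * poissonInt s ((1 / 2) * (t + t')) = poissonInt s t + poissonInt s t') : t = t' := by
  have ht := pos_of_poissonInt_ne_top hs h
  have ht' := pos_of_poissonInt_ne_top hs h'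
  have htm : 0 < (1 / 2) * (t + t') := by positivity
  have n1 := poisson_nonneg hs.le ht
  have n2 := poisson_nonneg hs.le ht'
  have n3 := poisson_nonneg hs.le htm
  rw [poissonInt_of_pos s ht, poissonInt_of_pos s ht', poissonInt_of_pos s htm,
    two_mul_ofReal, ← ENNReal.ofReal_add n1 n2,
    ENNReal.ofReal_eq_ofReal_iff (by linarith) (by linarith)] at heq
  by_contra hne
  have := log_midpoint_lt ht ht' hne
  nlinarith

theorem poissonInt_coercive {s : ℝ} (hs : 0 ≤ s) (t : ℝ) :
    ‖t‖ₑ ≤ 2 * poissonInt s t + ENNReal.ofReal (2 * (1 + s ^ 2)) := by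
  by_cases h : poissonInt s t = ⊤
  · simp [h]
  rcases (nonneg_of_poissonInt_ne_top h).eq_or_lt with rfl | ht
  · simp
  · have := poisson_nonneg hs ht
    rw [poissonInt_of_pos s ht, two_mul_ofReal, ← ENNReal.ofReal_add (by linarith) (by positivity),
      Real.enorm_eq_ofReal ht.le]
    apply ENNReal.ofReal_le_ofReal
    have := mul_log_le hs two_pos ht
    nlinarith

theorem admissible_poissonInt {Ω₀ : Set Plane} {f : Plane → ℝ}
    (hf : ∀ᵐ x ∂volume.restrict Ω₀, 0 ≤ f x) : Admissible Ω₀ f poissonInt where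
  measurable := measurable_poissonInt
  lsc := by filter_upwards [hf] with x hx using lowerSemicontinuous_poissonInt hx
  midpoint := by filter_upwards [hf] with x hx using poissonInt_midpoint hx
  coercive := by filter_upwards [hf] with x hx using poissonInt_coercive hx

/-! ### Uniqueness from the kernel condition -/

section

variable {Ω Ω₀ : Set Plane} {A : L2 Ω →L[ℝ] L2 Ω} {f : L2 Ω}

theorem eq_of_sub_mem_kerGrad (hΩ : IsOpen Ω) (hΩ₀ : IsOpen Ω₀) (hsub : Ω₀ ⊆ Ω)
    (hker : kerMasked Ω Ω₀ A ∩ kerGrad Ω = {0}) {g g' : L2 Ω} (h : g - g' ∈ kerGrad Ω)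
    (hA : ∀ᵐ x ∂volume.restrict Ω₀, A g x = A g' x) : g = g' := by
  have hm : g - g' ∈ kerMasked Ω Ω₀ A := by
    rw [mem_kerMasked_iff hΩ hΩ₀ hsub]
    filter_upwards [hA, ae_restrict_of_ae_restrict_of_subset hsub (Lp.coeFn_sub (A g) (A g'))]
      with x h1 h2
    rw [map_sub, h2, Pi.sub_apply, h1, sub_self]
  have : g - g' ∈ kerMasked Ω Ω₀ A ∩ kerGrad Ω := ⟨hm, h⟩
  rw [hker] at this
  exact sub_eq_zero.1 this

/-- Where `f = 0` the integrand is the value of `𝒜` itself, and `g = g' + c` with `c ≥ 0` gives `𝒜g'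
≤ 𝒜g` there. The integrands are thus ordered on all of `Ω₀`, and equal finite integrals make them
agree. -/
theorem ae_eq_of_poisson_fid_eq (hsub : Ω₀ ⊆ Ω)
    (hA1 : ∀ u : L2 Ω, (∀ᵐ x ∂volume.restrict Ω, u x = 1) →
      ∀ᵐ x ∂volume.restrict Ω₀, f x = 0 → 0 ≤ A u x)
    {g g' : L2 Ω} {c : ℝ} (hc : 0 ≤ c) (hconst : ∀ᵐ x ∂volume.restrict Ω, (g - g') x = c)
    (hfin : fid Ω₀ A poissonInt f g ≠ ⊤)
    (heq : fid Ω₀ A poissonInt f g = fid Ω₀ A poissonInt f g')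
    (hpos : ∀ᵐ x ∂volume.restrict Ω₀, f x ≠ 0 → A g x = A g' x)
    (hnn : ∀ᵐ x ∂volume.restrict Ω₀, 0 ≤ A g x ∧ 0 ≤ A g' x) :
    ∀ᵐ x ∂volume.restrict Ω₀, A g x = A g' x := by
  have hge : ∀ᵐ x ∂volume.restrict Ω₀, f x = 0 → A g' x ≤ A g x := by
    rcases hc.eq_or_lt with rfl | hc
    · have : g - g' = 0 := Lp.ext (by
        filter_upwards [hconst, Lp.coeFn_zero ℝ 2 (volume.restrict Ω)] with x h1 h2
        rw [h1, h2]; rfl)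
      rw [sub_eq_zero.1 this]
      exact Filter.Eventually.of_forall fun x _ => le_rfl
    -- Rescaled by `c⁻¹`, the difference is the constant function `1`, to which the sign hypothesis
    -- applies.
    · have h1 := hA1 (c⁻¹ • (g - g')) (by
        filter_upwards [hconst, Lp.coeFn_smul c⁻¹ (g - g')] with x h1 h2
        rw [h2, Pi.smul_apply, h1, smul_eq_mul, inv_mul_cancel₀ hc.ne'])
      rw [map_smul, map_sub] at h1
      filter_upwards [h1, ae_restrict_of_ae_restrict_of_subset hsub
        (Lp.coeFn_smul c⁻¹ (A g - A g')),
        ae_restrict_of_ae_restrict_of_subset hsub (Lp.coeFn_sub (A g) (A g'))] with x h1 h2 h3 hf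
      have := h1 hf
      rw [h2, Pi.smul_apply, h3, Pi.sub_apply, smul_eq_mul] at this
      exact sub_nonneg.1 (nonneg_of_mul_nonneg_right this (inv_pos.2 hc))
  have hle : (fun x => poissonInt (f x) (A g' x)) ≤ᵐ[volume.restrict Ω₀]
      fun x => poissonInt (f x) (A g x) := by
    filter_upwards [hge, hpos, hnn] with x h1 h2 h3
    by_cases hf : f x = 0
    · rw [hf, poissonInt_zero_left h3.1, poissonInt_zero_left h3.2]
      exact ENNReal.ofReal_le_ofReal (h1 hf)
    · rw [h2 hf]
  have hae := ae_eq_of_ae_le_of_lintegral_le hle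
    (show fid Ω₀ A poissonInt f g' ≠ ⊤ from heq ▸ hfin)
    (measurable_fid_integrand measurable_poissonInt f (A g)).aemeasurable heq.le
  filter_upwards [hae, hpos, hnn] with x h1 h2 h3
  by_cases hf : f x = 0
  · rw [hf, poissonInt_zero_left h3.1, poissonInt_zero_left h3.2,
      ENNReal.ofReal_eq_ofReal_iff h3.2 h3.1] at h1
    exact h1.symm
  · exact h2 hf

end

end Slat

/-! ### The two fidelities -/

theorem theorem1
    (Ω : Set Slat.Plane) (hΩ_bdd : Bornology.IsBounded Ω) (hΩ_conn : IsConnected Ω)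
    (hΩ_open : IsOpen Ω) (hΩ_lip : Slat.HasLipschitzBoundary Ω)
    (A : Slat.L2 Ω →L[ℝ] Slat.L2 Ω)
    (lam mu : ℝ) (hlam : 0 < lam) (hmu : 0 < mu)
    (d : ℕ) (f : Fin d → Slat.L2 Ω) (Ω₀ : Fin d → Set Slat.Plane) (i : Fin d)
    (hΩ₀_open : IsOpen (Ω₀ i)) (hΩ₀_ne : (Ω₀ i).Nonempty) (hΩ₀_sub : Ω₀ i ⊆ Ω)
    (hker : Slat.kerMasked Ω (Ω₀ i) A ∩ Slat.kerGrad Ω = {0}) :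
    -- Gaussian fidelity
    (∃! g : Slat.L2 Ω,
      Slat.IsMinimizer Ω (Slat.energy Ω (Ω₀ i) A lam mu Slat.gaussFid (f i)) g) ∧
    -- Poisson fidelity, for nonnegative data and a functional that is not identically `+∞`
    ((∀ᵐ x ∂(volume.restrict (Ω₀ i)), 0 ≤ f i x) →
      (∃ h ∈ Slat.W12 Ω, Slat.energy Ω (Ω₀ i) A lam mu Slat.poissonFid (f i) h < ⊤) →
      -- existence
      (∃ g : Slat.L2 Ω,
        Slat.IsMinimizer Ω (Slat.energy Ω (Ω₀ i) A lam mu Slat.poissonFid (f i)) g) ∧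
      -- existence and uniqueness, if `𝒜1 ≥ 0` almost everywhere on the part of `Ω₀` where `f = 0`
      ((∀ u : Slat.L2 Ω, (∀ᵐ x ∂(volume.restrict Ω), u x = 1) →
          ∀ᵐ x ∂(volume.restrict (Ω₀ i)), f i x = 0 → 0 ≤ A u x) →
        ∃! g : Slat.L2 Ω,
          Slat.IsMinimizer Ω (Slat.energy Ω (Ω₀ i) A lam mu Slat.poissonFid (f i)) g)) := by
  have hfm := Slat.isFiniteMeasure_restrict_of_isBounded hΩ_bdd
  have hm₀ := hΩ₀_open.measurableSet
  refine ⟨?_, fun hf hfin => ?_⟩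
  · have hψ := Slat.admissible_gaussInt (Ω₀ i) (f i)
    have hφ : ∀ᵐ x ∂volume.restrict (Ω₀ i), ∀ t, Slat.gaussFid (f i x) t =
        (Slat.gaussInt (f i x) t : EReal) - ((f i x ^ 2 : ℝ) : EReal) :=
      Filter.Eventually.of_forall fun x => Slat.gaussFid_eq _
    have hiff := Slat.isMinimizer_energy_iff (A := A) hm₀ hΩ₀_sub hlam hmu hψ.measurable hφ
    have hfin : ∃ h ∈ Slat.W12 Ω, Slat.total (Ω₀ i) A lam mu Slat.gaussInt (f i) h < ⊤ := by
      -- The zero function has finite Gaussian energy, so no finiteness assumption is needed.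
      refine ⟨0, ⟨0, (Slat.gradGraph Ω).zero_mem⟩, ?_⟩
      have hI : Integrable (fun x => (f i x - A 0 x) ^ 2 + f i x ^ 2) (volume.restrict Ω) :=
        ((Lp.memLp (f i)).sub (Lp.memLp (A 0))).integrable_sq.add (Lp.memLp (f i)).integrable_sq
      exact ENNReal.add_lt_top.2 ⟨ENNReal.mul_lt_top ENNReal.ofReal_lt_top
        ((lintegral_mono_set hΩ₀_sub).trans_lt hI.lintegral_lt_top), ENNReal.ofReal_lt_top⟩
    obtain ⟨g, hg, hgm⟩ := Slat.exists_minimizer_total hΩ_bdd hΩ_open hΩ_lip hΩ₀_open hΩ₀_sub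
      hker hlam hmu hψ hfin
    refine ⟨g, (hiff g).2 ⟨hg, hgm⟩, fun g' hg' => ?_⟩
    obtain ⟨hg', hgm'⟩ := (hiff g').1 hg'
    obtain ⟨hk, -, -, hae⟩ := Slat.minimizer_total_pair hΩ_bdd hΩ_open hΩ₀_sub hlam hmu hψ hfin
      hg' hg hgm' hgm
    refine Slat.eq_of_sub_mem_kerGrad hΩ_open hΩ₀_open hΩ₀_sub hker hk ?_
    filter_upwards [hae] with x hx using Slat.gaussInt_strict hx.2.2
  · have hψ := Slat.admissible_poissonInt hf
    have hφ : ∀ᵐ x ∂volume.restrict (Ω₀ i), ∀ t, Slat.poissonFid (f i x) t =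
        (Slat.poissonInt (f i x) t : EReal) - ((f i x ^ 2 : ℝ) : EReal) := by
      filter_upwards [hf] with x hx using Slat.poissonFid_eq hx
    have hiff := Slat.isMinimizer_energy_iff (A := A) hm₀ hΩ₀_sub hlam hmu hψ.measurable hφ
    have hfin' : ∃ h ∈ Slat.W12 Ω, Slat.total (Ω₀ i) A lam mu Slat.poissonInt (f i) h < ⊤ := by
      obtain ⟨h, hh, hlt⟩ := hfin
      exact ⟨h, hh, Slat.total_lt_top_of_energy_lt_top hm₀ hΩ₀_sub hlam hmu hψ.measurable hφ hlt⟩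
    obtain ⟨g, hg, hgm⟩ := Slat.exists_minimizer_total hΩ_bdd hΩ_open hΩ_lip hΩ₀_open hΩ₀_sub
      hker hlam hmu hψ hfin'
    refine ⟨⟨g, (hiff g).2 ⟨hg, hgm⟩⟩, fun hA1 => ⟨g, (hiff g).2 ⟨hg, hgm⟩, fun g' hg' => ?_⟩⟩
    obtain ⟨hg', hgm'⟩ := (hiff g').1 hg'
    obtain ⟨hk, hft', heq, hae⟩ := Slat.minimizer_total_pair hΩ_bdd hΩ_open hΩ₀_sub hlam hmu hψ
      hfin' hg' hg hgm' hgm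
    refine Slat.eq_of_sub_mem_kerGrad hΩ_open hΩ₀_open hΩ₀_sub hker hk ?_
    have hpos : ∀ᵐ x ∂volume.restrict (Ω₀ i), f i x ≠ 0 → A g' x = A g x := by
      filter_upwards [hae, hf] with x hx hfx hne
      exact Slat.poissonInt_strict (lt_of_le_of_ne hfx hne.symm) hx.1 hx.2.1 hx.2.2
    have hnn : ∀ᵐ x ∂volume.restrict (Ω₀ i), 0 ≤ A g' x ∧ 0 ≤ A g x := by
      filter_upwards [hae] with x hx
      exact ⟨Slat.nonneg_of_poissonInt_ne_top hx.1, Slat.nonneg_of_poissonInt_ne_top hx.2.1⟩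
    obtain ⟨c, hc⟩ := Slat.exists_ae_eq_const_of_mem_kerGrad hΩ_bdd hΩ_open hΩ_conn hk
    -- If the constant is negative, the two minimizers exchange roles.
    rcases le_total 0 c with h0 | h0
    · exact Slat.ae_eq_of_poisson_fid_eq hΩ₀_sub hA1 h0 hc hft' heq hpos hnn
    · have hc' : ∀ᵐ x ∂volume.restrict Ω, (g - g') x = -c := by
        filter_upwards [hc, Lp.coeFn_sub g g', Lp.coeFn_sub g' g] with x h1 h2 h3
        rw [h2, ← h1, h3, Pi.sub_apply, Pi.sub_apply, neg_sub]
      have := Slat.ae_eq_of_poisson_fid_eq hΩ₀_sub hA1 (neg_nonneg.2 h0) hc' (heq ▸ hft') heq.symm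
        (hpos.mono fun x hx h => (hx h).symm) (hnn.mono fun x hx => hx.symm)
      exact this.mono fun x hx => hx.symm
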